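/- Let $d\ge 0$ be an integer and let $V\colon\mathbf{R}^d\to\mathbf{R}$ be smooth and bounded from below. For $T>0$ let $\mathbf{P}^{(0)}_T$ be the law on $\mathcal{C}([0,T],\mathbf{R}^d)$ of the Brownian bridge from $0$ to $0$, i.e. of the continuous centred Gaussian process with $\mathbf{E}\,\Phi^i_s\Phi^j_u=\delta_{ij}\bigl(s\wedge u-\frac{su}{T}\bigr)$. For $t>0$ and $x,y\in\mathbf{R}^d$ define the Feynman–Kac heat kernel of $-\frac12\Delta+V$ by $$P^V_t(x,y)=(2\pi t)^{-d/2}e^{-\frac{|x-y|^2}{2t}}\int \exp\Bigl(-\int_0^t V\Bigl(\Phi_s+\frac{sy+(t-s)x}{t}\Bigr)\,ds\Bigr)\,\mathbf{P}^{(0)}_t(d\Phi).$$ Define measures on $\mathcal{C}([0,2t],\mathbf{R}^d)$ by $$\hat{\mathbf{P}}_t=\int_{\mathbf{R}^d}\tau^{(c)}_*\mathbf{P}^{(0)}_{2t}\,dc,\qquad \mathbf{P}^V_t(d\Phi)=(4\pi t)^{-d/2}\exp\Bigl(-\int_0^{2t}V(\Phi_s)\,ds\Bigr)\hat{\mathbf{P}}_t(d\Phi),$$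 where $(\tau^{(c)}\Phi)(s)=\Phi(s)+c$, and let $\pi\Phi=(\Phi_0,\Phi_t)\in\mathbf{R}^d\times\mathbf{R}^d$. For a Radon measure $\nu$ on a Polish space $\mathcal{X}$ and a measurable function $f\colon\mathcal{X}\to\mathbf{R}$ (defined up to $\nu$-null sets), consider the formal half-density $f\sqrt\nu$. Two half-densities $f_1\sqrt{\nu_1}$ and $f_2\sqrt{\nu_2}$ are equal if there is a Radon measure $\mu$ with $\nu_1,\nu_2\ll\mu$ such that $f_1\sqrt{\frac{d\nu_1}{d\mu}}=f_2\sqrt{\frac{d\nu_2}{d\mu}}$ holds $\mu$-almost everywhere. We write $\sqrt\nu$ for $1\cdot\sqrt\nu$. Then, for every $t>0$, the measure $\pi_*\mathbf{P}^V_t$ is Radon, $P^V_t$ is measurable, and one has the equality of half-densities on $\mathbf{R}^d\times\mathbf{R}^d$ $$P^V_t\,\sqrt{dx\,dy}=\sqrt{\pi_*\mathbf{P}^V_t}.$$ Moreover, these kernels form a semigroup: for all $s,t>0$ and $x,z\in\mathbf{R}^d$, the function $y\mapsto P^V_s(x,y)P^V_t(y,z)$ is integrable on $\mathbf{R}^d$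 and $$\int_{\mathbf{R}^d}P^V_s(x,y)\,P^V_t(y,z)\,dy=P^V_{s+t}(x,z).$$ -/

import Mathlib

open MeasureTheory ProbabilityTheory
open scoped ENNReal ContDiff

noncomputable section

namespace FeynmanKac

/-- The path space `C([0,T], ℝ^d)`. -/
abbrev PathSpace (d : ℕ) (T : ℝ) : Type :=
  C(Set.Icc (0 : ℝ) T, EuclideanSpace ℝ (Fin d))

/-- The σ-algebra on path space generated by the evaluations `Φ ↦ Φ s`. It is the Borel σ-algebra
of the topology of uniform convergence, because `C([0,T], ℝ^d)` is separable. -/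
instance instMeasurableSpacePathSpace (d : ℕ) (T : ℝ) : MeasurableSpace (PathSpace d T) :=
  MeasurableSpace.comap (fun Φ s => Φ s) MeasurableSpace.pi

/-- `P` is the law on `C([0,T], ℝ^d)` of a standard `d`-dimensional Brownian bridge, pinned at `0`
at the times `0` and `T`: under `P` the canonical process is a centred Gaussian process with
`E[Φ_s^i Φ_u^j] = δ_{ij} (min s u - s u / T)`. (A Gaussian process lives under a probability
measure, so `P` has total mass one.) -/
structure IsBrownianBridgeLaw (d : ℕ) (T : ℝ) (P : Measure (PathSpace d T)) : Prop where
  isGaussianProcess :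
    IsGaussianProcess (fun (s : Set.Icc (0 : ℝ) T) (Φ : PathSpace d T) => Φ s) P
  mean_eq_zero : ∀ s : Set.Icc (0 : ℝ) T, ∫ Φ : PathSpace d T, Φ s ∂P = 0
  covariance_eq : ∀ (s u : Set.Icc (0 : ℝ) T) (i j : Fin d),
    cov[fun Φ : PathSpace d T => Φ s i, fun Φ : PathSpace d T => Φ u j; P] =
      if i = j then min (s : ℝ) u - (s : ℝ) * u / T else 0

open Classical in
/-- The law of the `d`-dimensional Brownian bridge on `[0,T]`, for `T > 0`: the (unique)
measure with the property `IsBrownianBridgeLaw`. -/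
def bridgeLaw (d : ℕ) (T : ℝ) : Measure (PathSpace d T) :=
  if h : ∃ P : Measure (PathSpace d T), IsBrownianBridgeLaw d T P then h.choose else 0

/-- Lebesgue measure on the interval `[0,T]`, regarded as a subtype of `ℝ`. -/
def lebesgueIcc (T : ℝ) : Measure (Set.Icc (0 : ℝ) T) :=
  (volume : Measure ℝ).comap Subtype.val

/-- The heat kernel `(2πt)^{-d/2} exp (-|x-y|² / (2t))` of `½Δ` on `ℝ^d`. -/
def heatKernel (d : ℕ) (t : ℝ) (x y : EuclideanSpace ℝ (Fin d)) : ℝ :=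
  (2 * Real.pi * t) ^ (-(d : ℝ) / 2) * Real.exp (-‖x - y‖ ^ 2 / (2 * t))

/-- The Feynman-Kac kernel
`P_t^V(x,y) = P_t(x,y) E exp (-∫₀ᵗ V(Φ_s + (s y + (t-s) x)/t) ds)`, where `Φ` is a Brownian
bridge on `[0,t]`. -/
def kernel (d : ℕ) (V : EuclideanSpace ℝ (Fin d) → ℝ) (t : ℝ)
    (x y : EuclideanSpace ℝ (Fin d)) : ℝ :=
  heatKernel d t x y *
    ∫ Φ : PathSpace d t,
      Real.exp (-∫ s : Set.Icc (0 : ℝ) t,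
        V (Φ s + t⁻¹ • ((s : ℝ) • y + (t - (s : ℝ)) • x)) ∂(lebesgueIcc t)) ∂(bridgeLaw d t)

/-- The translation `(τ^{(c)} Φ)(s) = Φ(s) + c` on path space. -/
def translate (d : ℕ) (T : ℝ) (c : EuclideanSpace ℝ (Fin d)) (Φ : PathSpace d T) :
    PathSpace d T :=
  Φ + ContinuousMap.const _ c

/-- The measure `∫ (τ^{(c)}_* P) dc` on `C([0,2t], ℝ^d)`, where `P` is the law of the Brownian
bridge on `[0,2t]` and `dc` is Lebesgue measure on `ℝ^d`. -/
def freeLoopMeasure (d : ℕ) (t : ℝ) : Measure (PathSpace d (2 * t)) :=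
  Measure.bind (volume : Measure (EuclideanSpace ℝ (Fin d)))
    (fun c => (bridgeLaw d (2 * t)).map (translate d (2 * t) c))

/-- The measure `exp (-∫₀^{2t} V(Φ_s) ds) (4πt)^{-d/2} (∫ (τ^{(c)}_* P) dc)(dΦ)`. -/
def loopMeasure (d : ℕ) (V : EuclideanSpace ℝ (Fin d) → ℝ) (t : ℝ) :
    Measure (PathSpace d (2 * t)) :=
  (ENNReal.ofReal ((4 * Real.pi * t) ^ (-(d : ℝ) / 2)) • freeLoopMeasure d t).withDensity
    (fun Φ => ENNReal.ofReal (Real.exp (-∫ s : Set.Icc (0 : ℝ) (2 * t), V (Φ s) ∂(lebesgueIcc (2 * t)))))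

/-- The map `π Φ = (Φ_0, Φ_t)` on `C([0,2t], ℝ^d)`. -/
def endpoints (d : ℕ) (t : ℝ) (ht : 0 < t) (Φ : PathSpace d (2 * t)) :
    EuclideanSpace ℝ (Fin d) × EuclideanSpace ℝ (Fin d) :=
  (Φ ⟨0, by constructor <;> linarith⟩, Φ ⟨t, by constructor <;> linarith⟩)

/-- The expression `f √ν` makes sense: `ν` is a Radon measure (on a Polish space these are the
locally finite Borel measures) and `f` is a measurable function defined up to `ν`-null sets. -/
structure IsHalfDensity {X : Type*} [TopologicalSpace X] [MeasurableSpace X]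
    (f : X → ℝ) (ν : Measure X) : Prop where
  isLocallyFiniteMeasure : IsLocallyFiniteMeasure ν
  aemeasurable : AEMeasurable f ν

/-- Equality `f₁ √ν₁ = f₂ √ν₂` of half-densities: there is a Radon measure `μ` with
`ν₁, ν₂ ≪ μ` such that `f₁ √(dν₁/dμ) = f₂ √(dν₂/dμ)` holds `μ`-almost everywhere. -/
def HalfDensityEq {X : Type*} [TopologicalSpace X] [MeasurableSpace X]
    (f₁ : X → ℝ) (ν₁ : Measure X) (f₂ : X → ℝ) (ν₂ : Measure X) : Prop :=
  IsHalfDensity f₁ ν₁ ∧ IsHalfDensity f₂ ν₂ ∧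
    ∃ μ : Measure X, IsLocallyFiniteMeasure μ ∧ ν₁ ≪ μ ∧ ν₂ ≪ μ ∧
      ∀ᵐ z ∂μ, f₁ z * √((ν₁.rnDeriv μ z).toReal) = f₂ z * √((ν₂.rnDeriv μ z).toReal)

end FeynmanKac

end

/-! The heart is the Markov property of the bridge at an intermediate time `s` of `[0,T]`, `T = s +
t`. A bridge on `[0,T]` is the sum of a bridge on `[0,s]`, a bridge on `[0,t]` and a tent-shaped
piecewise affine path with Gaussian height of variance `s * t / T`, all three independent
(`map_glue_bridgeLaw`). Add the affine path from `x` to `z` and condition on the value `y` at time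
`s`: the two halves become independent bridges from `x` to `y` and from `y` to `z`, the energy
splits, and the Gaussian densities combine by completing the square (`heatKernel_mul_heatKernel`).
The result is `lintegral_bridge_eq`: the Feynman-Kac integral over bridges from `x` to `z`, with a
test function `g` of the value at time `s`, equals the integral of `g y` against the product of the
kernels from `x` to `y` and from `y` to `z`.

Taking `g = 1` gives the semigroup law. Taking `s = t` and `x = z = c`, then integrating over `c`,
shows that the image of the loop measure has Lebesgue density K(c,y) K(y,c). Time reversal makes the
kernel K symmetric, so this density is its square; as K is nonnegative, the square root of the
density is K.

Every identity between bridge laws reduces to an identity of covariances, because the joint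
characteristic functions determine the law (`HasBridgeCharFun.eq`). Existence of the bridge comes
from the Lévy-Ciesielski series. -/

namespace FeynmanKac

open scoped RealInnerProductSpace
open Finset Filter Topology

/-! ### Bridge laws and their joint characteristic functions -/

section CharacteristicFunction

/-- The covariance function of the scalar Brownian bridge on `[0,T]`. -/
noncomputable def bridgeCov (T s u : ℝ) : ℝ := min s u - s * u / T

/-- The characteristic functions of the finite-dimensional distributions of `P` are those of the
Brownian bridge. -/
def HasBridgeCharFun (d : ℕ) (T : ℝ) (P : Measure (PathSpace d T)) : Prop :=
  ∀ {ι : Type} [Fintype ι] (τ : ι → Set.Icc (0 : ℝ) T) (a : ι → EuclideanSpace ℝ (Fin d)),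
    ∫ Φ : PathSpace d T, Complex.exp ((∑ i, ⟪a i, Φ (τ i)⟫ : ℝ) * Complex.I) ∂P =
      Complex.exp (-(∑ i, ∑ j, bridgeCov T (τ i) (τ j) * ⟪a i, a j⟫ : ℝ) / 2)

variable {d : ℕ} {T : ℝ}

lemma measurable_eval (s : Set.Icc (0 : ℝ) T) : Measurable fun Φ : PathSpace d T => Φ s :=
  (measurable_pi_apply s).comp (comap_measurable _)

lemma measurable_coe_pathSpace :
    Measurable fun (Φ : PathSpace d T) (s : Set.Icc (0 : ℝ) T) => Φ s :=
  comap_measurable _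

lemma measurable_pathSpace {Ω : Type*} [MeasurableSpace Ω] {f : Ω → PathSpace d T}
    (hf : ∀ s, Measurable fun z => f z s) : Measurable f :=
  measurable_comap_iff.2 (measurable_pi_lambda _ hf)

lemma cov_inner_inner {Ω : Type*} [MeasurableSpace Ω] {P : Measure Ω} [IsProbabilityMeasure P]
    {X Y : Ω → EuclideanSpace ℝ (Fin d)} (hX : MemLp X 2 P) (hY : MemLp Y 2 P) {c : ℝ}
    (h : ∀ i j, cov[fun z => X z i, fun z => Y z j; P] = if i = j then c else 0)
    (a b : EuclideanSpace ℝ (Fin d)) :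
    cov[fun z => ⟪a, X z⟫, fun z => ⟪b, Y z⟫; P] = c * ⟪a, b⟫ := by
  have hX' (i : Fin d) : MemLp (fun z => a i * X z i) 2 P :=
    ((EuclideanSpace.proj (𝕜 := ℝ) i).comp_memLp' hX).const_mul _
  have hY' (i : Fin d) : MemLp (fun z => b i * Y z i) 2 P :=
    ((EuclideanSpace.proj (𝕜 := ℝ) i).comp_memLp' hY).const_mul _
  simp_rw [PiLp.inner_apply, RCLike.inner_apply, conj_trivial, mul_comm _ (a.ofLp _),
    mul_comm _ (b.ofLp _)]
  rw [covariance_fun_sum_fun_sum hX' hY', Finset.mul_sum]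
  refine Finset.sum_congr rfl fun i _ => ?_
  simp_rw [covariance_const_mul_left, covariance_const_mul_right, h]
  rw [Finset.sum_eq_single i] <;> simp +contextual [eq_comm]
  ring

theorem IsBrownianBridgeLaw.hasBridgeCharFun {P : Measure (PathSpace d T)}
    (h : IsBrownianBridgeLaw d T P) : HasBridgeCharFun d T P := by
  intro ι _ τ a
  have := h.1.isProbabilityMeasure
  have hL (s) : HasGaussianLaw (fun Φ : PathSpace d T => Φ s) P :=
    h.1.hasGaussianLaw_eval s
  have hG : HasGaussianLaw (fun (Φ : PathSpace d T) => ∑ i, ⟪a i, Φ (τ i)⟫) P := by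
    classical
    have := h.1.hasGaussianLaw (Finset.univ.image τ)
    let L : ((Finset.univ.image τ) → EuclideanSpace ℝ (Fin d)) →L[ℝ] ℝ :=
      ∑ i, (innerSL ℝ (a i)).comp (ContinuousLinearMap.proj ⟨τ i, by simp⟩)
    convert! this.map_fun L with Φ
    simp [L]
  have key := hG.charFun_map_eq 1
  rw [charFun_apply, integral_map hG.aemeasurable (by fun_prop)] at key
  have hmean : ∫ Φ : PathSpace d T, ∑ i, ⟪a i, Φ (τ i)⟫ ∂P = 0 := by
    rw [integral_finsetSum _ fun i _ => (hL (τ i)).integrable.const_inner (a i)]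
    refine Finset.sum_eq_zero fun i _ => ?_
    rw [integral_inner (hL (τ i)).integrable, h.mean_eq_zero, inner_zero_right]
  have hvar : Var[fun Φ : PathSpace d T => ∑ i, ⟪a i, Φ (τ i)⟫; P] =
      ∑ i, ∑ j, bridgeCov T (τ i) (τ j) * ⟪a i, a j⟫ := by
    rw [variance_fun_sum' fun i _ => (hL (τ i)).memLp_two.const_inner (a i)]
    refine Finset.sum_congr rfl fun i _ => Finset.sum_congr rfl fun j _ => ?_
    exact cov_inner_inner (hL _).memLp_two (hL _).memLp_two
      (fun k l => h.covariance_eq (τ i) (τ j) k l) _ _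
  have e1 (x : ℝ) : (⟪x, (1 : ℝ)⟫) = x := by simp
  have e2 (x : ℝ) : (⟪(1 : ℝ), x⟫) = x := by simp
  simp only [e1, e2, hmean, hvar] at key
  rw [key]
  congr 1
  push_cast
  ring

section CharFun

variable {P : Measure (PathSpace d T)} [IsProbabilityMeasure P]

lemma HasBridgeCharFun.exists_map_eq (h : HasBridgeCharFun d T P) {ι : Type} [Fintype ι]
    (τ : ι → Set.Icc (0 : ℝ) T) (a : ι → EuclideanSpace ℝ (Fin d)) :
    ∃ v : NNReal, (v : ℝ) = ∑ i, ∑ j, bridgeCov T (τ i) (τ j) * ⟪a i, a j⟫ ∧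
      P.map (fun Φ : PathSpace d T => ∑ i, ⟪a i, Φ (τ i)⟫) = gaussianReal 0 v := by
  have hmeas : Measurable fun Φ : PathSpace d T => ∑ i, ⟪a i, Φ (τ i)⟫ :=
    Finset.measurable_sum _ fun i _ => (measurable_eval (τ i)).const_inner
  set w : ℝ := ∑ i, ∑ j, bridgeCov T (τ i) (τ j) * ⟪a i, a j⟫ with hw
  -- An expectation of unimodular numbers has modulus at most 1, whereas `exp (-w / 2)` would exceed
  -- 1 for negative `w`.
  have hw0 : 0 ≤ w := by
    by_contra! hneg
    have h1 : ‖∫ Φ : PathSpace d T, Complex.exp ((∑ i, ⟪a i, Φ (τ i)⟫ : ℝ) * Complex.I) ∂P‖ ≤ 1 := by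
      refine (norm_integral_le_of_norm_le_const (C := 1) (ae_of_all _ fun Φ => ?_)).trans (by simp)
      rw [Complex.norm_exp_ofReal_mul_I]
    rw [h τ a, ← hw, Complex.norm_exp] at h1
    rw [Real.exp_le_one_iff] at h1
    norm_cast at h1
    linarith
  obtain ⟨v, hv⟩ : ∃ v : NNReal, (v : ℝ) = w := ⟨⟨w, hw0⟩, rfl⟩
  refine ⟨v, hv, ?_⟩
  have := Measure.isProbabilityMeasure_map (μ := P) hmeas.aemeasurable
  refine Measure.ext_of_charFun (funext fun t => ?_)
  rw [charFun_apply_real, integral_map hmeas.aemeasurable (by fun_prop), charFun_gaussianReal]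
  have := h τ (fun i => t • a i)
  have e : ∑ i, ∑ j, bridgeCov T (τ i) (τ j) * ⟪t • a i, t • a j⟫ = t ^ 2 * w := by
    simp only [hw, Finset.mul_sum, inner_smul_left, inner_smul_right, conj_trivial]
    refine Finset.sum_congr rfl fun i _ => Finset.sum_congr rfl fun j _ => ?_
    ring
  rw [e] at this
  simp only [inner_smul_left, conj_trivial, ← Finset.mul_sum] at this
  push_cast at this ⊢
  rw [this, ← hv]
  congr 1
  ring

theorem HasBridgeCharFun.isBrownianBridgeLaw (h : HasBridgeCharFun d T P) :
    IsBrownianBridgeLaw d T P := by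
  have hG : IsGaussianProcess (fun (s : Set.Icc (0 : ℝ) T) (Φ : PathSpace d T) => Φ s) P := by
    refine ⟨fun I => ⟨isGaussian_of_map_eq_gaussianReal fun L => ?_⟩⟩
    classical
    -- Riesz representatives of the components of `L`: they turn an arbitrary functional of the
    -- marginal into a sum of inner products.
    let a (i : I) : EuclideanSpace ℝ (Fin d) :=
      (InnerProductSpace.toDual ℝ _).symm (L ∘L ContinuousLinearMap.single ℝ (fun _ => EuclideanSpace ℝ (Fin d)) i)
    obtain ⟨v, -, hv⟩ := h.exists_map_eq (fun i : I => i.1) a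
    refine ⟨0, v, ?_⟩
    have hm : Measurable fun Φ : PathSpace d T => I.restrict (Φ ·) :=
      measurable_pi_lambda _ fun i => measurable_eval i.1
    rw [← hv, Measure.map_map L.continuous.measurable hm]
    congr 1
    ext Φ
    simp only [a, InnerProductSpace.toDual_symm_apply, Function.comp]
    exact (L.sum_comp_single _ _ _).symm
  have hL (s) : HasGaussianLaw (fun Φ : PathSpace d T => Φ s) P := hG.hasGaussianLaw_eval s
  refine ⟨hG, fun s => ?_, fun s u i j => ?_⟩
  · refine ext_inner_left ℝ fun a => ?_
    rw [← integral_inner (hL s).integrable, inner_zero_right]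
    obtain ⟨v, -, hv⟩ := h.exists_map_eq (fun _ : Fin 1 => s) (fun _ => a)
    have : ∫ x, x ∂(P.map fun Φ : PathSpace d T => ∑ i : Fin 1, ⟪a, Φ s⟫) = 0 := by
      rw [hv, integral_id_gaussianReal]
    rw [integral_map (by
      simpa using (measurable_eval s).const_inner.aemeasurable) (by fun_prop)] at this
    simpa using this
  -- Covariances are recovered from variances by polarization, setting `a` or `b` to zero for the
  -- diagonal terms.
  · have hvar (a b : EuclideanSpace ℝ (Fin d)) :
        Var[fun Φ : PathSpace d T => ⟪a, Φ s⟫ + ⟪b, Φ u⟫; P] =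
          bridgeCov T s s * ⟪a, a⟫ + 2 * (bridgeCov T s u * ⟪a, b⟫) + bridgeCov T u u * ⟪b, b⟫ := by
      obtain ⟨v, hv, hv'⟩ := h.exists_map_eq ![s, u] ![a, b]
      have hm : Measurable fun Φ : PathSpace d T => ⟪a, Φ s⟫ + ⟪b, Φ u⟫ :=
        (measurable_eval s).const_inner.add (measurable_eval u).const_inner
      simp only [Fin.sum_univ_two, Matrix.cons_val_zero, Matrix.cons_val_one] at hv hv'
      have := variance_map (X := id) aemeasurable_id hm.aemeasurable (μ := P)
      rw [hv', variance_id_gaussianReal, hv, Function.id_comp] at this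
      rw [← this, real_inner_comm b a, bridgeCov, bridgeCov, bridgeCov, bridgeCov,
        min_comm (u : ℝ) s]
      ring
    have hX : MemLp (fun Φ : PathSpace d T => ⟪EuclideanSpace.single i (1 : ℝ), Φ s⟫) 2 P :=
      (hL s).memLp_two.const_inner _
    have hY : MemLp (fun Φ : PathSpace d T => ⟪EuclideanSpace.single j (1 : ℝ), Φ u⟫) 2 P :=
      (hL u).memLp_two.const_inner _
    have h1 := variance_fun_add hX hY
    have h2 := hvar (EuclideanSpace.single i 1) 0
    have h3 := hvar 0 (EuclideanSpace.single j 1)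
    simp only [inner_zero_left, inner_zero_right, add_zero, zero_add, mul_zero] at h2 h3
    rw [hvar, h2, h3] at h1
    have h4 : cov[fun Φ : PathSpace d T => ⟪EuclideanSpace.single i (1 : ℝ), Φ s⟫,
        fun Φ : PathSpace d T => ⟪EuclideanSpace.single j (1 : ℝ), Φ u⟫; P] =
        bridgeCov T s u * ⟪EuclideanSpace.single i (1 : ℝ), EuclideanSpace.single j (1 : ℝ)⟫ := by
      linarith
    simp only [EuclideanSpace.inner_single_left, map_one, one_mul] at h4
    rw [h4, bridgeCov]
    by_cases hij : i = j <;> simp [hij]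

/-- Characteristic functions fix the finite-dimensional marginals, these fix the law on the product
space, and the σ-algebra on paths is pulled back from that product. -/
lemma HasBridgeCharFun.eq {Q : Measure (PathSpace d T)}
    [IsProbabilityMeasure Q] (hP : HasBridgeCharFun d T P) (hQ : HasBridgeCharFun d T Q) :
    P = Q := by
  have hm (I : Finset (Set.Icc (0 : ℝ) T)) : Measurable fun Φ : PathSpace d T => I.restrict (Φ ·) :=
    measurable_pi_lambda _ fun i => measurable_eval i.1
  have hfd (I : Finset (Set.Icc (0 : ℝ) T)) :
      P.map (fun Φ : PathSpace d T => I.restrict (Φ ·)) = Q.map (fun Φ => I.restrict (Φ ·)) := by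
    have := Measure.isProbabilityMeasure_map (μ := P) (hm I).aemeasurable
    have := Measure.isProbabilityMeasure_map (μ := Q) (hm I).aemeasurable
    refine Measure.ext_of_charFunDual (funext fun L => ?_)
    rw [charFunDual_apply, charFunDual_apply, integral_map (hm I).aemeasurable (by fun_prop),
      integral_map (hm I).aemeasurable (by fun_prop)]
    classical
    let a (i : I) : EuclideanSpace ℝ (Fin d) :=
      (InnerProductSpace.toDual ℝ _).symm (L ∘L ContinuousLinearMap.single ℝ (fun _ => EuclideanSpace ℝ (Fin d)) i)
    have hL (Φ : PathSpace d T) : L (I.restrict (Φ ·)) = ∑ i : I, ⟪a i, Φ i.1⟫ := by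
      simp only [a, InnerProductSpace.toDual_symm_apply]
      exact (L.sum_comp_single _ _ _).symm
    simp_rw [hL]
    rw [hP (fun i : I => i.1) a, hQ (fun i : I => i.1) a]
  have hpi : P.map (fun (Φ : PathSpace d T) s => Φ s) = Q.map (fun Φ s => Φ s) := by
    have h1 := isProjectiveLimit_map (P := P) (X := fun s (Φ : PathSpace d T) => Φ s)
      measurable_coe_pathSpace.aemeasurable
    have h2 := isProjectiveLimit_map (P := Q) (X := fun s (Φ : PathSpace d T) => Φ s)
      measurable_coe_pathSpace.aemeasurable
    simp_rw [hfd] at h1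
    have (I : Finset (Set.Icc (0 : ℝ) T)) :
        IsFiniteMeasure (Q.map (fun Φ : PathSpace d T => I.restrict (Φ ·))) := inferInstance
    exact h1.unique h2
  ext A hA
  obtain ⟨B, hB, rfl⟩ := hA
  rw [← Measure.map_apply measurable_coe_pathSpace hB, hpi,
    Measure.map_apply measurable_coe_pathSpace hB]

end CharFun

end CharacteristicFunction

/-! ### Existence of the bridge: Schauder expansion of the covariance -/

section Existence

/-- The tent function supported in `[0,1]`, with maximum `1/2`. -/
noncomputable def tent (u : ℝ) : ℝ := max 0 (min u (1 - u))

lemma continuous_tent : Continuous tent := by unfold tent; fun_prop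

lemma tent_nonneg (u : ℝ) : 0 ≤ tent u := le_max_left _ _

/-- The covariance of the Brownian bridge on `[0,1]`, extended by zero. -/
noncomputable def unitBridgeCov (u v : ℝ) : ℝ := max 0 (min u v) * max 0 (1 - max u v)

lemma unitBridgeCov_comm (u v : ℝ) : unitBridgeCov u v = unitBridgeCov v u := by
  simp only [unitBridgeCov, min_comm, max_comm u v]

lemma unitBridgeCov_nonneg (u v : ℝ) : 0 ≤ unitBridgeCov u v :=
  mul_nonneg (le_max_left _ _) (le_max_left _ _)

lemma unitBridgeCov_le_tent (u v : ℝ) : unitBridgeCov u v ≤ tent u := by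
  rcases le_or_gt u 0 with h | h
  · rw [unitBridgeCov, max_eq_left ((min_le_left _ _).trans h), zero_mul]
    exact tent_nonneg u
  rcases le_or_gt 1 u with h' | h'
  · rw [unitBridgeCov, max_eq_left (a := (0 : ℝ)) (b := 1 - max u v)
      (by linarith [le_max_left u v]), mul_zero]
    exact tent_nonneg u
  have h1 : max 0 (min u v) ≤ u := max_le h.le (min_le_left _ _)
  have h2 : max 0 (1 - max u v) ≤ 1 - u := max_le (by linarith) (by linarith [le_max_left u v])
  have h3 : (0 : ℝ) ≤ max 0 (min u v) := le_max_left _ _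
  have h4 : (0 : ℝ) ≤ max 0 (1 - max u v) := le_max_left _ _
  unfold unitBridgeCov tent
  refine le_max_of_le_right (le_min ?_ ?_) <;> nlinarith

/-- Lévy's midpoint construction at the level of covariances: a bridge is a random multiple of the
tent plus two independent half-size bridges. Iteration yields the Schauder expansion. -/
lemma unitBridgeCov_eq (u v : ℝ) :
    unitBridgeCov u v = tent u * tent v +
      (unitBridgeCov (2 * u) (2 * v) + unitBridgeCov (2 * u - 1) (2 * v - 1)) / 2 := by
  wlog huv : u ≤ v generalizing u v
  · rw [unitBridgeCov_comm u, unitBridgeCov_comm (2 * u), unitBridgeCov_comm (2 * u - 1),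
      this v u (by linarith)]
    ring
  unfold unitBridgeCov tent
  rw [min_eq_left huv, max_eq_right huv, min_eq_left (show 2 * u ≤ 2 * v by linarith),
    max_eq_right (show 2 * u ≤ 2 * v by linarith),
    min_eq_left (show 2 * u - 1 ≤ 2 * v - 1 by linarith),
    max_eq_right (show 2 * u - 1 ≤ 2 * v - 1 by linarith)]
  rcases le_total u 0 with h0 | h0
  · rw [max_eq_left h0, max_eq_left ((min_le_left _ _).trans h0),
      max_eq_left (show 2 * u ≤ 0 by linarith), max_eq_left (show 2 * u - 1 ≤ 0 by linarith)]
    ring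
  rcases le_total 1 v with h1 | h1
  · rw [max_eq_left (show 1 - v ≤ 0 by linarith),
      max_eq_left ((min_le_right v (1 - v)).trans (show 1 - v ≤ 0 by linarith)),
      max_eq_left (show 1 - 2 * v ≤ 0 by linarith),
      max_eq_left (show 1 - (2 * v - 1) ≤ 0 by linarith)]
    ring
  rw [max_eq_right h0, max_eq_right (show 0 ≤ 1 - v by linarith),
    max_eq_right (show 0 ≤ 2 * u by linarith),
    max_eq_right (show 0 ≤ 1 - (2 * v - 1) by linarith),
    max_eq_right (show 0 ≤ min u (1 - u) from le_min h0 (by linarith)),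
    max_eq_right (show 0 ≤ min v (1 - v) from le_min (by linarith) (by linarith))]
  rcases le_total u (1 / 2) with h2 | h2 <;> rcases le_total v (1 / 2) with h3 | h3
  · rw [min_eq_left (show u ≤ 1 - u by linarith), min_eq_left (show v ≤ 1 - v by linarith),
      max_eq_left (show 2 * u - 1 ≤ 0 by linarith), max_eq_right (show 0 ≤ 1 - 2 * v by linarith)]
    ring
  · rw [min_eq_left (show u ≤ 1 - u by linarith), min_eq_right (show 1 - v ≤ v by linarith),
      max_eq_left (show 2 * u - 1 ≤ 0 by linarith), max_eq_left (show 1 - 2 * v ≤ 0 by linarith)]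
    ring
  · obtain rfl : u = 1 / 2 := by linarith
    obtain rfl : v = 1 / 2 := by linarith
    norm_num
  · rw [min_eq_right (show 1 - u ≤ u by linarith), min_eq_right (show 1 - v ≤ v by linarith),
      max_eq_right (show 0 ≤ 2 * u - 1 by linarith), max_eq_left (show 1 - 2 * v ≤ 0 by linarith)]
    ring

/-- Integer translates of the tent have disjoint interiors of support, so only `k = ⌊x⌋` can
contribute. -/
lemma sum_tent_sub_le_one (x : ℝ) (m : ℕ) : ∑ k ∈ range m, tent (x - k) ≤ 1 := by
  have h (k : ℕ) : tent (x - k) ≤ if (k : ℤ) = ⌊x⌋ then 1 else 0 := by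
    split_ifs with hk
    · unfold tent
      refine max_le zero_le_one ?_
      by_cases h : x - k ≤ 1
      · exact (min_le_left _ _).trans h
      · exact (min_le_right _ _).trans (by linarith)
    · refine (max_le le_rfl ?_)
      by_contra! h
      obtain ⟨h1, h2⟩ := lt_min_iff.1 h
      exact hk (Int.floor_eq_iff.2 ⟨by push_cast; linarith, by push_cast; linarith⟩).symm
  refine (Finset.sum_le_sum fun k _ => h k).trans ?_
  rcases le_or_gt 0 ⌊x⌋ with h0 | h0
  · obtain ⟨j, hj⟩ := Int.eq_ofNat_of_zero_le h0
    simp only [hj, Nat.cast_inj, Finset.sum_ite_eq']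
    split_ifs <;> norm_num
  · rw [Finset.sum_eq_zero]
    · exact zero_le_one
    · intro k _
      rw [if_neg (by omega)]

lemma unitBridgeCov_eq_sum (N : ℕ) (u v : ℝ) :
    unitBridgeCov u v =
      ∑ n ∈ range N, (1 / 2) ^ n * ∑ k ∈ range (2 ^ n), tent (2 ^ n * u - k) * tent (2 ^ n * v - k) +
      (1 / 2) ^ N * ∑ k ∈ range (2 ^ N), unitBridgeCov (2 ^ N * u - k) (2 ^ N * v - k) := by
  induction N with
  | zero => simp
  | succ N ih =>
    have h2 (f : ℕ → ℝ) (m : ℕ) :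
        ∑ k ∈ range (m * 2), f k = ∑ k ∈ range m, (f (2 * k) + f (2 * k + 1)) := by
      induction m with
      | zero => simp
      | succ m ih => rw [add_mul, one_mul, Finset.sum_range_succ, Finset.sum_range_succ, ih,
          Finset.sum_range_succ, mul_comm m 2, add_assoc]
    rw [ih, Finset.sum_range_succ, add_assoc, pow_succ 2 N, h2]
    congr 1
    rw [pow_succ (1 / 2 : ℝ), mul_assoc, ← mul_add, Finset.mul_sum (a := (1 / 2 : ℝ)),
      ← Finset.sum_add_distrib]
    congr 1
    refine Finset.sum_congr rfl fun k _ => ?_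
    rw [unitBridgeCov_eq]
    push_cast
    rw [show 2 * (2 ^ N * u - (k : ℝ)) = 2 ^ (N + 1) * u - 2 * k by ring,
      show 2 * (2 ^ N * v - (k : ℝ)) = 2 ^ (N + 1) * v - 2 * k by ring, sub_sub, sub_sub]
    ring

lemma tendsto_sum_tent_mul_tent (u v : ℝ) :
    Tendsto (fun N => ∑ n ∈ range N,
      (1 / 2 : ℝ) ^ n * ∑ k ∈ range (2 ^ n), tent (2 ^ n * u - k) * tent (2 ^ n * v - k))
      atTop (𝓝 (unitBridgeCov u v)) := by
  -- The remainder after `N` levels is at most `(1 / 2) ^ N`, since each covariance is dominated by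
  -- a tent.
  have h0 : Tendsto (fun N => (1 / 2 : ℝ) ^ N * ∑ k ∈ range (2 ^ N),
      unitBridgeCov (2 ^ N * u - k) (2 ^ N * v - k)) atTop (𝓝 0) := by
    refine squeeze_zero (fun N => ?_) (fun N => ?_)
      (tendsto_pow_atTop_nhds_zero_of_lt_one (r := (1 / 2 : ℝ)) (by norm_num) (by norm_num))
    · exact mul_nonneg (by positivity) (Finset.sum_nonneg fun _ _ => unitBridgeCov_nonneg _ _)
    · refine mul_le_of_le_one_right (by positivity) ?_
      exact (Finset.sum_le_sum fun k _ => unitBridgeCov_le_tent _ _).trans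
        (sum_tent_sub_le_one _ _)
  have := (tendsto_const_nhds (x := unitBridgeCov u v)).sub h0
  rw [sub_zero] at this
  refine this.congr fun N => ?_
  rw [unitBridgeCov_eq_sum N u v]
  ring

lemma mul_unitBridgeCov {T : ℝ} (hT : 0 < T) (s u : Set.Icc (0 : ℝ) T) :
    T * unitBridgeCov (s / T) (u / T) = bridgeCov T s u := by
  wlog hsu : (s : ℝ) ≤ u generalizing s u
  · rw [unitBridgeCov_comm, this u s (by linarith), bridgeCov, bridgeCov, min_comm, mul_comm (s : ℝ)]
  have h1 : (s : ℝ) / T ≤ u / T := by gcongr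
  have h2 : 0 ≤ (s : ℝ) / T := div_nonneg s.2.1 hT.le
  have h3 : (u : ℝ) / T ≤ 1 := (div_le_one hT).2 u.2.2
  rw [unitBridgeCov, bridgeCov, min_eq_left h1, max_eq_right h1, min_eq_left hsu,
    max_eq_right h2, max_eq_right (by linarith)]
  field_simp

/-- The fourth root of `1/2`. -/
noncomputable def levyRatio : ℝ := √√(1 / 2)

lemma levyRatio_pos : 0 < levyRatio := by unfold levyRatio; positivity

lemma levyRatio_pow_four : levyRatio ^ 4 = 1 / 2 := by
  rw [show 4 = 2 * 2 from rfl, pow_mul, levyRatio, Real.sq_sqrt (by positivity),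
    Real.sq_sqrt (by positivity)]

lemma levyRatio_lt_one : levyRatio < 1 := by
  by_contra! h
  have := one_le_pow₀ h (n := 4)
  rw [levyRatio_pow_four] at this
  norm_num at this

/-- The index set of the Schauder functions of the first `N` dyadic levels. -/
def levyIndex (N : ℕ) : Finset (Σ _ : ℕ, ℕ) := (range N).sigma fun n => range (2 ^ n)

/-- The Schauder functions on `[0,T]`. -/
noncomputable def schauder (T : ℝ) (w : Σ _ : ℕ, ℕ) (t : ℝ) : ℝ :=
  √T * (levyRatio ^ (2 * w.1) * tent (2 ^ w.1 * (t / T) - w.2))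

lemma tendsto_sum_schauder_mul_schauder {T : ℝ} (hT : 0 < T) (s u : Set.Icc (0 : ℝ) T) :
    Tendsto (fun N => ∑ w ∈ levyIndex N, schauder T w s * schauder T w u) atTop
      (𝓝 (bridgeCov T s u)) := by
  rw [← mul_unitBridgeCov hT]
  refine ((tendsto_sum_tent_mul_tent (s / T) (u / T)).const_mul T).congr fun N => ?_
  rw [levyIndex, Finset.sum_sigma, Finset.mul_sum]
  refine Finset.sum_congr rfl fun n _ => ?_
  rw [Finset.mul_sum, Finset.mul_sum]
  refine Finset.sum_congr rfl fun k _ => ?_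
  have h1 : √T * √T = T := Real.mul_self_sqrt hT.le
  have h2 : levyRatio ^ (2 * n) * levyRatio ^ (2 * n) = (1 / 2) ^ n := by
    rw [← pow_add, ← levyRatio_pow_four, ← pow_mul]
    ring
  simp only [schauder]
  linear_combination (-(√T * √T * (tent (2 ^ n * (s / T) - k) * tent (2 ^ n * (u / T) - k)))) * h2 -
    (1 / 2) ^ n * (tent (2 ^ n * (s / T) - k) * tent (2 ^ n * (u / T) - k)) * h1

/-! ### Existence of the bridge: uniform convergence of the random series -/

section Series

variable (d : ℕ) (T : ℝ)

/-- The law of a family of independent standard Gaussian vectors. -/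
noncomputable def levyNoise : Measure ((Σ _ : ℕ, ℕ) → EuclideanSpace ℝ (Fin d)) :=
  Measure.infinitePi fun _ => stdGaussian (EuclideanSpace ℝ (Fin d))

instance : IsProbabilityMeasure (levyNoise d) := by unfold levyNoise; infer_instance

variable {d}

lemma integral_exp_levyNoise (A : Finset (Σ _ : ℕ, ℕ))
    (b : (Σ _ : ℕ, ℕ) → EuclideanSpace ℝ (Fin d)) :
    ∫ Z, Complex.exp ((∑ w ∈ A, ⟪b w, Z w⟫ : ℝ) * Complex.I) ∂(levyNoise d) =
      Complex.exp (-(∑ w ∈ A, ‖b w‖ ^ 2 : ℝ) / 2) := by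
  have hm (w) : Measurable fun Z : (Σ _ : ℕ, ℕ) → EuclideanSpace ℝ (Fin d) => ⟪b w, Z w⟫ :=
    (measurable_pi_apply w).const_inner
  have hind : iIndepFun (fun w (Z : (Σ _ : ℕ, ℕ) → EuclideanSpace ℝ (Fin d)) => ⟪b w, Z w⟫)
      (levyNoise d) :=
    iIndepFun_infinitePi (X := fun w (x : EuclideanSpace ℝ (Fin d)) => ⟪b w, x⟫)
      fun w => measurable_id.const_inner
  have := congrFun ((hind.precomp (g := fun w : A => w.1)
    Subtype.val_injective).charFun_map_fun_finsetSum_eq_prod (s := A)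
    fun w _ => (hm w).aemeasurable) 1
  have hm' : Measurable fun Z : (Σ _ : ℕ, ℕ) → EuclideanSpace ℝ (Fin d) =>
    ∑ w ∈ A, ⟪b w, Z w⟫ := Finset.measurable_sum _ fun w _ => hm w
  have e1 (x : ℝ) : (⟪x, (1 : ℝ)⟫) = x := by simp
  rw [charFun_apply, integral_map hm'.aemeasurable (by fun_prop), Finset.prod_apply] at this
  simp only [e1] at this
  rw [this]
  have hone (w) : charFun ((levyNoise d).map fun Z => ⟪b w, Z w⟫) 1 =
      Complex.exp (-(‖b w‖ ^ 2 : ℝ) / 2) := by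
    rw [charFun_apply, integral_map (hm w).aemeasurable (by fun_prop)]
    simp only [e1]
    have h2 := charFun_stdGaussian (b w)
    rw [charFun_apply, ← Measure.infinitePi_map_eval
      (fun _ : (Σ _ : ℕ, ℕ) => stdGaussian (EuclideanSpace ℝ (Fin d))) w,
      integral_map (measurable_pi_apply w).aemeasurable (by fun_prop)] at h2
    simp only [real_inner_comm (b w)] at h2
    rw [levyNoise]
    push_cast
    exact h2
  rw [Finset.prod_congr rfl fun w _ => hone w, ← Complex.exp_sum]
  congr 1
  push_cast
  rw [← Finset.sum_div, Finset.sum_neg_distrib]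

/-- The power 8 beats the `2 ^ n` terms of level `n`: `levyRatio ^ 8 = 1 / 4` leaves the summable
`(1 / 2) ^ n`, while the power 4 would leave a constant. -/
lemma lintegral_enorm_pow_stdGaussian_ne_top :
    ∫⁻ x, ‖x‖ₑ ^ 8 ∂(stdGaussian (EuclideanSpace ℝ (Fin d))) ≠ ⊤ := by
  have h := IsGaussian.memLp_id (stdGaussian (EuclideanSpace ℝ (Fin d))) 8 (by simp)
  have := lintegral_rpow_enorm_lt_top_of_eLpNorm_lt_top (by simp) (by simp) h.2
  refine ne_of_lt ?_
  simp only [id, ENNReal.toReal_ofNat] at this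
  exact_mod_cast this

lemma measurable_enorm_smul_pow (w : Σ _ : ℕ, ℕ) :
    Measurable fun Z : (Σ _ : ℕ, ℕ) → EuclideanSpace ℝ (Fin d) =>
      ‖levyRatio ^ w.1 • Z w‖ₑ ^ 8 :=
  ((measurable_const_smul _).comp (measurable_pi_apply w)).enorm.pow_const _

lemma lintegral_enorm_smul_pow_levyNoise (w : Σ _ : ℕ, ℕ) :
    ∫⁻ Z, ‖levyRatio ^ w.1 • Z w‖ₑ ^ 8 ∂(levyNoise d) =
      ENNReal.ofReal ((1 / 4) ^ w.1) *
        ∫⁻ x, ‖x‖ₑ ^ 8 ∂(stdGaussian (EuclideanSpace ℝ (Fin d))) := by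
  have e (x : EuclideanSpace ℝ (Fin d)) : ‖levyRatio ^ w.1 • x‖ₑ ^ 8 =
      ENNReal.ofReal ((1 / 4) ^ w.1) * ‖x‖ₑ ^ 8 := by
    have h8 : levyRatio ^ 8 = 1 / 4 := by
      rw [show 8 = 4 * 2 from rfl, pow_mul, levyRatio_pow_four]; norm_num
    rw [enorm_smul, mul_pow, ← enorm_pow,
      Real.enorm_of_nonneg (pow_nonneg (pow_nonneg levyRatio_pos.le _) _),
      ← pow_mul, mul_comm w.1, pow_mul, h8]
  simp only [e]
  have hm : Measurable fun x : EuclideanSpace ℝ (Fin d) => ‖x‖ₑ ^ 8 :=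
    measurable_id.enorm.pow_const _
  have hm' : Measurable fun Z : (Σ _ : ℕ, ℕ) → EuclideanSpace ℝ (Fin d) => ‖Z w‖ₑ ^ 8 :=
    hm.comp (measurable_pi_apply w)
  rw [lintegral_const_mul _ hm']
  congr 1
  rw [← Measure.infinitePi_map_eval
    (fun _ : (Σ _ : ℕ, ℕ) => stdGaussian (EuclideanSpace ℝ (Fin d))) w,
    lintegral_map hm (measurable_pi_apply w)]
  rfl

/-- The sum of all eighth powers has finite expectation, hence is almost surely finite and bounds
each of its terms. -/
lemma ae_exists_levyRatio_mul_norm_le :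
    ∀ᵐ Z ∂(levyNoise d), ∃ M : ℝ, ∀ n, ∀ k < 2 ^ n, levyRatio ^ n * ‖Z ⟨n, k⟩‖ ≤ M := by
  have hfin : ∫⁻ Z, ∑' n, ∑ k ∈ range (2 ^ n), ‖levyRatio ^ n • Z ⟨n, k⟩‖ₑ ^ 8 ∂(levyNoise d) ≠ ⊤ := by
    rw [lintegral_tsum fun n => (Finset.measurable_sum _ fun k _ => measurable_enorm_smul_pow ⟨n, k⟩).aemeasurable]
    have (n : ℕ) : ∫⁻ Z, ∑ k ∈ range (2 ^ n), ‖levyRatio ^ n • Z ⟨n, k⟩‖ₑ ^ 8 ∂(levyNoise d) =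
        ENNReal.ofReal ((1 / 2) ^ n) *
          ∫⁻ x, ‖x‖ₑ ^ 8 ∂(stdGaussian (EuclideanSpace ℝ (Fin d))) := by
      rw [lintegral_finsetSum _ fun k _ => measurable_enorm_smul_pow ⟨n, k⟩,
        Finset.sum_congr rfl fun k _ => lintegral_enorm_smul_pow_levyNoise ⟨n, k⟩]
      simp only []
      rw [Finset.sum_const, card_range, nsmul_eq_mul,
        ← mul_assoc, ← ENNReal.ofReal_natCast, ← ENNReal.ofReal_mul (by positivity)]
      push_cast
      rw [← mul_pow]
      norm_num
    simp only [this]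
    rw [ENNReal.tsum_mul_right, ← ENNReal.ofReal_tsum_of_nonneg (fun n => by positivity)
      (summable_geometric_of_lt_one (by norm_num) (by norm_num))]
    exact ENNReal.mul_ne_top ENNReal.ofReal_ne_top lintegral_enorm_pow_stdGaussian_ne_top
  have hmS : Measurable fun Z : (Σ _ : ℕ, ℕ) → EuclideanSpace ℝ (Fin d) =>
      ∑' n, ∑ k ∈ range (2 ^ n), ‖levyRatio ^ n • Z ⟨n, k⟩‖ₑ ^ 8 :=
    Measurable.tsum fun n => Finset.measurable_sum _ fun k _ => measurable_enorm_smul_pow ⟨n, k⟩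
  filter_upwards [ae_lt_top hmS hfin] with Z hZ
  set S := ∑' n, ∑ k ∈ range (2 ^ n), ‖levyRatio ^ n • Z ⟨n, k⟩‖ₑ ^ 8 with hS
  -- Adding 1 avoids an eighth root: `S ≤ 1 + S ≤ (1 + S) ^ 8`.
  refine ⟨1 + S.toReal, fun n k hk => ?_⟩
  have h1 : ‖levyRatio ^ n • Z ⟨n, k⟩‖ₑ ^ 8 ≤ S :=
    (Finset.single_le_sum (f := fun k => ‖levyRatio ^ n • Z ⟨n, k⟩‖ₑ ^ 8)
      (fun _ _ => zero_le) (Finset.mem_range.2 hk)).trans (ENNReal.le_tsum n)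
  have h2 := ENNReal.toReal_mono hZ.ne h1
  rw [ENNReal.toReal_pow, toReal_enorm, norm_smul, Real.norm_of_nonneg
    (pow_nonneg levyRatio_pos.le _)] at h2
  have h0 : 0 ≤ S.toReal := ENNReal.toReal_nonneg
  refine le_of_pow_le_pow_left₀ (n := 8) (by norm_num) (by positivity) (h2.trans ?_)
  exact (le_add_of_nonneg_left zero_le_one).trans (le_self_pow₀ (by linarith) (by norm_num))

/-- The partial sums of the Lévy-Ciesielski series of the Brownian bridge on `[0,T]`. -/
noncomputable def levyPath (N : ℕ) (Z : (Σ _ : ℕ, ℕ) → EuclideanSpace ℝ (Fin d)) :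
    PathSpace d T where
  toFun t := ∑ w ∈ levyIndex N, schauder T w t • Z w
  continuous_toFun := by
    have := continuous_tent
    unfold schauder
    fun_prop

variable {T}

/-- The Schauder factor `levyRatio ^ (2 * n)` is split in two: one `levyRatio ^ n` controls the
noise, the other gives geometric decay of level `n` in sup norm, as the tents of one level sum to at
most 1. -/
lemma exists_tendsto_levyPath {Z : (Σ _ : ℕ, ℕ) → EuclideanSpace ℝ (Fin d)}
    (hZ : ∃ M : ℝ, ∀ n, ∀ k < 2 ^ n, levyRatio ^ n * ‖Z ⟨n, k⟩‖ ≤ M) :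
    ∃ Φ, Tendsto (fun N => levyPath T N Z) atTop (𝓝 Φ) := by
  obtain ⟨M, hM⟩ := hZ
  have hM0 : 0 ≤ M := (by positivity : 0 ≤ levyRatio ^ 0 * ‖Z ⟨0, 0⟩‖).trans (hM 0 0 (by norm_num))
  have hq := levyRatio_pos
  refine cauchySeq_tendsto_of_complete
    (cauchySeq_of_le_geometric levyRatio (√T * M) levyRatio_lt_one fun N => ?_)
  rw [ContinuousMap.dist_le (by positivity)]
  intro t
  simp only [levyPath, ContinuousMap.coe_mk, levyIndex, Finset.sum_sigma]
  rw [Finset.sum_range_succ, dist_eq_norm, sub_add_cancel_left, norm_neg]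
  calc ‖∑ k ∈ range (2 ^ N), schauder T ⟨N, k⟩ t • Z ⟨N, k⟩‖
      ≤ ∑ k ∈ range (2 ^ N), √T * M * levyRatio ^ N * tent (2 ^ N * (t / T) - k) := by
        refine norm_sum_le_of_le _ fun k hk => ?_
        have h1 := hM N k (Finset.mem_range.1 hk)
        have h2 := tent_nonneg (2 ^ N * (t / T) - k)
        rw [norm_smul, schauder, Real.norm_of_nonneg (by positivity)]
        calc √T * (levyRatio ^ (2 * N) * tent (2 ^ N * (t / T) - k)) * ‖Z ⟨N, k⟩‖
            = √T * levyRatio ^ N * tent (2 ^ N * (t / T) - k) * (levyRatio ^ N * ‖Z ⟨N, k⟩‖) := by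
              ring
          _ ≤ √T * levyRatio ^ N * tent (2 ^ N * (t / T) - k) * M := by gcongr
          _ = _ := by ring
    _ ≤ √T * M * levyRatio ^ N := by
        rw [← Finset.mul_sum]
        exact mul_le_of_le_one_right (by positivity) (sum_tent_sub_le_one _ _)

lemma integral_exp_levyPath (N : ℕ) {ι : Type} [Fintype ι] (τ : ι → Set.Icc (0 : ℝ) T)
    (a : ι → EuclideanSpace ℝ (Fin d)) :
    ∫ Z, Complex.exp ((∑ i, ⟪a i, levyPath T N Z (τ i)⟫ : ℝ) * Complex.I) ∂(levyNoise d) =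
      Complex.exp (-(∑ i, ∑ j, (∑ w ∈ levyIndex N, schauder T w (τ i) * schauder T w (τ j)) *
        ⟪a i, a j⟫ : ℝ) / 2) := by
  have h1 (Z : (Σ _ : ℕ, ℕ) → EuclideanSpace ℝ (Fin d)) : ∑ i, ⟪a i, levyPath T N Z (τ i)⟫ =
      ∑ w ∈ levyIndex N, ⟪∑ i, schauder T w (τ i) • a i, Z w⟫ := by
    simp only [levyPath, ContinuousMap.coe_mk, inner_sum, sum_inner, inner_smul_left,
      inner_smul_right, conj_trivial]
    exact Finset.sum_comm
  simp only [h1]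
  rw [integral_exp_levyNoise]
  congr 4
  simp only [← real_inner_self_eq_norm_sq, inner_sum, sum_inner, inner_smul_left,
    inner_smul_right, conj_trivial, Finset.sum_mul]
  rw [Finset.sum_comm]
  refine Finset.sum_congr rfl fun i _ => ?_
  simp only [Finset.mul_sum]
  rw [Finset.sum_comm]
  refine Finset.sum_congr rfl fun j _ => Finset.sum_congr rfl fun w _ => ?_
  rw [real_inner_comm]
  ring

theorem exists_isBrownianBridgeLaw (d : ℕ) (hT : 0 < T) :
    ∃ P : Measure (PathSpace d T), IsBrownianBridgeLaw d T P := by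
  set B := {Z : (Σ _ : ℕ, ℕ) → EuclideanSpace ℝ (Fin d) |
    ¬ ∃ Φ, Tendsto (fun N => levyPath T N Z) atTop (𝓝 Φ)} with hB
  have hB0 : levyNoise d B = 0 := by
    have : ∀ᵐ Z ∂(levyNoise d), ∃ Φ, Tendsto (fun N => levyPath T N Z) atTop (𝓝 Φ) := by
      filter_upwards [ae_exists_levyRatio_mul_norm_le] with Z hZ using exists_tendsto_levyPath hZ
    exact this
  -- A measurable set of full measure on which the series converges. Replacing the partial sums by 0
  -- off `G` makes them converge everywhere, so the limit is measurable.
  set G := (toMeasurable (levyNoise d) B)ᶜ with hG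
  have hGm : MeasurableSet G := (measurableSet_toMeasurable _ _).compl
  have hGae : ∀ᵐ Z ∂(levyNoise d), Z ∈ G := by
    rw [ae_iff]
    simpa [hG, measure_toMeasurable] using hB0
  have hex (Z) : ∃ Φ, Tendsto (fun N => G.indicator (levyPath T N) Z) atTop (𝓝 Φ) := by
    by_cases hZ : Z ∈ G
    · simp only [Set.indicator_of_mem hZ]
      by_contra h
      exact hZ (subset_toMeasurable _ _ h)
    · simp only [Set.indicator_of_notMem hZ]
      exact ⟨0, tendsto_const_nhds⟩
  choose X hX using hex
  have hev (t : Set.Icc (0 : ℝ) T) : Continuous fun Φ : PathSpace d T => Φ t :=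
    ContinuousEvalConst.continuous_eval_const t
  have hpm (N) : Measurable (levyPath (d := d) T N) := by
    refine measurable_pathSpace fun t => ?_
    simp only [levyPath, ContinuousMap.coe_mk]
    exact Finset.measurable_sum _ fun w _ =>
      (measurable_const_smul _).comp (measurable_pi_apply w)
  have hXm : Measurable X := by
    refine measurable_pathSpace fun t => ?_
    refine measurable_of_tendsto_metrizable (f := fun N Z => G.indicator (levyPath T N) Z t)
      (fun N => ?_) (tendsto_pi_nhds.2 fun Z => ((hev t).tendsto _).comp (hX Z))
    exact (measurable_eval t).comp ((hpm N).indicator hGm)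
  have := Measure.isProbabilityMeasure_map (μ := levyNoise d) hXm.aemeasurable
  refine ⟨(levyNoise d).map X, HasBridgeCharFun.isBrownianBridgeLaw ?_⟩
  intro ι _ τ a
  have hexpm : Measurable fun Φ : PathSpace d T =>
      Complex.exp ((∑ i, ⟪a i, Φ (τ i)⟫ : ℝ) * Complex.I) :=
    Complex.measurable_exp.comp ((Complex.measurable_ofReal.comp
      (Finset.measurable_sum _ fun i _ => (measurable_eval (τ i)).const_inner)).mul_const _)
  rw [integral_map hXm.aemeasurable hexpm.aestronglyMeasurable]
  have hlim1 : Tendsto (fun N => ∫ Z, Complex.exp ((∑ i, ⟪a i, levyPath T N Z (τ i)⟫ : ℝ) *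
      Complex.I) ∂(levyNoise d)) atTop
      (𝓝 (∫ Z, Complex.exp ((∑ i, ⟪a i, X Z (τ i)⟫ : ℝ) * Complex.I) ∂(levyNoise d))) := by
    refine tendsto_integral_of_dominated_convergence (fun _ => 1)
      (fun N => (hexpm.comp (hpm N)).aestronglyMeasurable) (integrable_const _)
      (fun N => ae_of_all _ fun Z => by rw [Complex.norm_exp_ofReal_mul_I]) ?_
    filter_upwards [hGae] with Z hZ
    have h1 := hX Z
    simp only [Set.indicator_of_mem hZ] at h1
    have hc : Continuous fun Φ : PathSpace d T =>
        Complex.exp ((∑ i, ⟪a i, Φ (τ i)⟫ : ℝ) * Complex.I) := by fun_prop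
    exact (hc.tendsto _).comp h1
  have hlim2 : Tendsto (fun N => ∫ Z, Complex.exp ((∑ i, ⟪a i, levyPath T N Z (τ i)⟫ : ℝ) *
      Complex.I) ∂(levyNoise d)) atTop
      (𝓝 (Complex.exp (-(∑ i, ∑ j, bridgeCov T (τ i) (τ j) * ⟪a i, a j⟫ : ℝ) / 2))) := by
    simp only [integral_exp_levyPath]
    have h1 : Tendsto (fun N => ∑ i, ∑ j, (∑ w ∈ levyIndex N, schauder T w (τ i) *
        schauder T w (τ j)) * ⟪a i, a j⟫) atTop
        (𝓝 (∑ i, ∑ j, bridgeCov T (τ i) (τ j) * ⟪a i, a j⟫)) :=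
      tendsto_finsetSum _ fun i _ => tendsto_finsetSum _ fun j _ =>
        (tendsto_sum_schauder_mul_schauder hT _ _).mul_const _
    have hc : Continuous fun x : ℝ => Complex.exp (-(x : ℂ) / 2) := by fun_prop
    exact (hc.tendsto _).comp h1
  exact tendsto_nhds_unique hlim1 hlim2

lemma isBrownianBridgeLaw_bridgeLaw (d : ℕ) (hT : 0 < T) :
    IsBrownianBridgeLaw d T (bridgeLaw d T) := by
  have h := exists_isBrownianBridgeLaw d hT
  rw [bridgeLaw, dif_pos h]
  exact h.choose_spec

end Series

end Existence

/-! ### Splitting and reversing the bridge -/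

section Decomposition

variable {d : ℕ}

lemma hasBridgeCharFun_bridgeLaw (d : ℕ) {T : ℝ} (hT : 0 < T) :
    HasBridgeCharFun d T (bridgeLaw d T) :=
  (isBrownianBridgeLaw_bridgeLaw d hT).hasBridgeCharFun

lemma isProbabilityMeasure_bridgeLaw (d : ℕ) {T : ℝ} (hT : 0 < T) :
    IsProbabilityMeasure (bridgeLaw d T) :=
  have : Nonempty (Set.Icc (0 : ℝ) T) := ⟨⟨0, le_rfl, hT.le⟩⟩
  (isBrownianBridgeLaw_bridgeLaw d hT).1.isProbabilityMeasure

instance (T : ℝ) : IsFiniteMeasure (bridgeLaw d T) := by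
  rw [bridgeLaw]
  split_ifs with h
  · have := h.choose_spec.1.isProbabilityMeasure
    infer_instance
  · infer_instance

/-- Zero variance forces the Dirac mass at 0. It is applied at the two ends of the interval, where
paths are pinned only almost surely. -/
lemma ae_bridgeLaw_eval_eq_zero {T : ℝ} (hT : 0 < T) {s : Set.Icc (0 : ℝ) T}
    (hs : bridgeCov T s s = 0) : ∀ᵐ Φ ∂(bridgeLaw d T), Φ s = 0 := by
  have := isProbabilityMeasure_bridgeLaw d hT
  have := Measure.isProbabilityMeasure_map (μ := bridgeLaw d T) (measurable_eval s).aemeasurable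
  have hmap : (bridgeLaw d T).map (fun Φ => Φ s) = Measure.dirac 0 := by
    refine Measure.ext_of_charFun (funext fun a => ?_)
    rw [charFun_apply, integral_map (measurable_eval s).aemeasurable (by fun_prop), charFun_dirac]
    have := hasBridgeCharFun_bridgeLaw d hT (fun _ : Fin 1 => s) fun _ => a
    simp only [univ_unique, Fin.default_eq_zero, Fin.isValue, sum_const, card_singleton, one_smul,
      hs, zero_mul] at this
    simp only [real_inner_comm a] at this ⊢
    simpa using this
  have h0 : ∀ᵐ x ∂((bridgeLaw d T).map (fun Φ => Φ s)), x = 0 := by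
    rw [hmap]
    exact (ae_dirac_iff (p := (· = 0)) (measurableSet_singleton 0)).2 rfl
  exact ae_of_ae_map (measurable_eval s).aemeasurable h0

lemma heatKernel_nonneg {t : ℝ} (ht : 0 < t) (x y : EuclideanSpace ℝ (Fin d)) :
    0 ≤ heatKernel d t x y := by
  unfold heatKernel
  positivity

lemma continuous_heatKernel (t : ℝ) :
    Continuous fun z : EuclideanSpace ℝ (Fin d) × EuclideanSpace ℝ (Fin d) =>
      heatKernel d t z.1 z.2 := by
  unfold heatKernel
  fun_prop

/-- The centred Gaussian measure on `ℝ^d` with covariance `v` times the identity. -/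
noncomputable def heatMeasure (d : ℕ) (v : ℝ) : Measure (EuclideanSpace ℝ (Fin d)) :=
  volume.withDensity fun y => ENNReal.ofReal (heatKernel d v 0 y)

lemma measurable_heatKernel_zero (v : ℝ) :
    Measurable fun y : EuclideanSpace ℝ (Fin d) => heatKernel d v 0 y :=
  have h : Continuous fun y : EuclideanSpace ℝ (Fin d) =>
      ((0, y) : EuclideanSpace ℝ (Fin d) × EuclideanSpace ℝ (Fin d)) := by fun_prop
  ((continuous_heatKernel v).comp h).measurable

lemma integral_exp_heatMeasure {v : ℝ} (hv : 0 < v) (a : EuclideanSpace ℝ (Fin d)) :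
    ∫ y, Complex.exp ((⟪a, y⟫ : ℝ) * Complex.I) ∂(heatMeasure d v) =
      Complex.exp (-(v * ‖a‖ ^ 2 : ℝ) / 2) := by
  rw [heatMeasure, integral_withDensity_eq_integral_toReal_smul
    (measurable_heatKernel_zero v).ennreal_ofReal (ae_of_all _ fun _ => ENNReal.ofReal_lt_top)]
  -- With `b = 1 / (2 * v)` the Gaussian integral produces `(2πv)^(d/2)`, which cancels the
  -- normalization of the heat kernel.
  have hG := GaussianFourier.integral_cexp_neg_mul_sq_norm_add (b := ((1 / (2 * v) : ℝ) : ℂ))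
    (by rw [Complex.ofReal_re]; positivity) Complex.I a
  have h1 (y : EuclideanSpace ℝ (Fin d)) :
      (ENNReal.ofReal (heatKernel d v 0 y)).toReal • Complex.exp ((⟪a, y⟫ : ℝ) * Complex.I) =
        (((2 * Real.pi * v) ^ (-(d : ℝ) / 2) : ℝ) : ℂ) *
          Complex.exp (-((1 / (2 * v) : ℝ) : ℂ) * ‖y‖ ^ 2 + Complex.I * (⟪a, y⟫ : ℝ)) := by
    rw [ENNReal.toReal_ofReal (heatKernel_nonneg hv _ _), heatKernel, zero_sub, norm_neg,
      Complex.real_smul, Complex.exp_add]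
    push_cast
    rw [mul_comm Complex.I, ← mul_assoc]
    congr 3
    ring
  simp only [h1]
  rw [integral_const_mul, hG, finrank_euclideanSpace, Fintype.card_fin, ← mul_assoc]
  have h2 : ((Real.pi : ℂ) / ((1 / (2 * v) : ℝ) : ℂ)) ^ ((d : ℂ) / 2) =
      (((2 * Real.pi * v) ^ ((d : ℝ) / 2) : ℝ) : ℂ) := by
    rw [Complex.ofReal_cpow (by positivity)]
    push_cast
    congr 1
    field_simp
  rw [h2, ← Complex.ofReal_mul, ← Real.rpow_add (by positivity)]
  rw [show -(d : ℝ) / 2 + d / 2 = 0 by ring, Real.rpow_zero, Complex.ofReal_one, one_mul,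
    Complex.I_sq]
  congr 1
  push_cast
  have : (v : ℂ) ≠ 0 := by exact_mod_cast hv.ne'
  field_simp
  ring

lemma isProbabilityMeasure_heatMeasure {v : ℝ} (hv : 0 < v) :
    IsProbabilityMeasure (heatMeasure d v) := by
  have := integral_exp_heatMeasure (d := d) hv 0
  simp only [inner_zero_left, Complex.ofReal_zero, zero_mul, Complex.exp_zero, integral_const,
    Complex.real_smul, mul_one, norm_zero] at this
  have h : (heatMeasure d v).real Set.univ = 1 := by
    have h' : (((heatMeasure d v).real Set.univ : ℝ) : ℂ) = 1 := by rw [this]; simp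
    exact_mod_cast h'
  exact ⟨(ENNReal.toReal_eq_one_iff _).1 h⟩

instance (v : ℝ) : SFinite (heatMeasure d v) := by unfold heatMeasure; infer_instance

section Glue

variable {s t T : ℝ}

/-- The path on `[0,T]`, where `T = s + t`, built from a path on `[0,s]`, a path on `[0,t]`, and
the piecewise affine path with value `y` at time `s` that vanishes at the times `0` and `T`. -/
noncomputable def glue (d : ℕ) (T : ℝ) (hs : 0 < s) (ht : 0 < t)
    (p : EuclideanSpace ℝ (Fin d) × PathSpace d s × PathSpace d t) : PathSpace d T where
  toFun u := p.2.1 (Set.projIcc 0 s hs.le u) + p.2.2 (Set.projIcc 0 t ht.le (u - s)) +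
    min ((u : ℝ) / s) ((T - u) / t) • p.1
  continuous_toFun := by
    have h1 : Continuous (Set.projIcc 0 s hs.le) := continuous_projIcc
    have h2 : Continuous (Set.projIcc 0 t ht.le) := continuous_projIcc
    fun_prop

lemma measurable_glue (hs : 0 < s) (ht : 0 < t) : Measurable (glue d T hs ht) := by
  refine measurable_pathSpace fun u => ?_
  refine Measurable.add (Measurable.add ?_ ?_) ((measurable_const_smul _).comp measurable_fst)
  · exact (measurable_eval _).comp (measurable_fst.comp measurable_snd)
  · exact (measurable_eval _).comp (measurable_snd.comp measurable_snd)

/-- `s * t / T` is the variance of the bridge at time `s`. When `u ≤ s ≤ v`, both short-bridge terms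
vanish, since clamping sends one time to an endpoint; the affine part carries the whole covariance.
-/
lemma bridgeCov_add (hs : 0 < s) (ht : 0 < t) (hT : T = s + t) (u v : Set.Icc (0 : ℝ) T) :
    bridgeCov s (Set.projIcc 0 s hs.le u) (Set.projIcc 0 s hs.le v) +
      bridgeCov t (Set.projIcc 0 t ht.le (u - s)) (Set.projIcc 0 t ht.le (v - s)) +
      s * t / T * (min ((u : ℝ) / s) ((T - u) / t) * min ((v : ℝ) / s) ((T - v) / t)) =
    bridgeCov T u v := by
  wlog huv : (u : ℝ) ≤ v generalizing u v
  · have := this v u (by linarith)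
    simp only [bridgeCov, min_comm, mul_comm] at this ⊢
    exact this
  obtain ⟨u, hu0, hu1⟩ := u
  obtain ⟨v, hv0, hv1⟩ := v
  simp only at huv
  have hTp : 0 < T := by linarith
  have hle (w : ℝ) (h : w ≤ s) : min (w / s) ((T - w) / t) = w / s := by
    refine min_eq_left ?_
    rw [div_le_div_iff₀ hs ht]
    nlinarith
  have hge (w : ℝ) (h : s ≤ w) : min (w / s) ((T - w) / t) = (T - w) / t := by
    refine min_eq_right ?_
    rw [div_le_div_iff₀ ht hs]
    nlinarith
  simp only [bridgeCov, Set.coe_projIcc, min_eq_left huv]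
  rcases le_total u s with h1 | h1 <;> rcases le_total v s with h2 | h2
  · rw [hle u h1, hle v h2, min_eq_right h1, min_eq_right h2, max_eq_right hu0, max_eq_right hv0,
      min_eq_right (show u - s ≤ t by linarith), min_eq_right (show v - s ≤ t by linarith),
      max_eq_left (show u - s ≤ 0 by linarith), max_eq_left (show v - s ≤ 0 by linarith),
      min_eq_left huv, min_self]
    subst hT
    field_simp
    ring
  · rw [hle u h1, hge v h2, min_eq_right h1, min_eq_left h2, max_eq_right hu0,
      max_eq_right hs.le,
      min_eq_right (show u - s ≤ t by linarith), min_eq_right (show v - s ≤ t by linarith),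
      max_eq_left (show u - s ≤ 0 by linarith), max_eq_right (show 0 ≤ v - s by linarith),
      min_eq_left h1, min_eq_left (show 0 ≤ v - s by linarith)]
    subst hT
    field_simp
    ring
  · obtain rfl : u = s := by linarith
    obtain rfl : v = u := by linarith
    rw [hle v le_rfl, min_self, min_self, max_eq_right hs.le, sub_self, min_eq_right ht.le, max_self, min_self]
    subst hT
    field_simp
    ring
  · rw [hge u h1, hge v h2, min_eq_left h1, min_eq_left h2, max_eq_right hs.le,
      min_eq_right (show u - s ≤ t by linarith), min_eq_right (show v - s ≤ t by linarith),
      max_eq_right (show 0 ≤ u - s by linarith), max_eq_right (show 0 ≤ v - s by linarith),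
      min_eq_left (show u - s ≤ v - s by linarith), min_self]
    subst hT
    field_simp
    ring

/-- By independence the characteristic function factors in three, and the exponents add up by
`bridgeCov_add`. -/
theorem map_glue_bridgeLaw (hs : 0 < s) (ht : 0 < t) (hT : T = s + t) :
    ((heatMeasure d (s * t / T)).prod ((bridgeLaw d s).prod (bridgeLaw d t))).map
      (glue d T hs ht) = bridgeLaw d T := by
  have hTp : 0 < T := by linarith
  have hv : 0 < s * t / T := by positivity
  have := isProbabilityMeasure_bridgeLaw d hs
  have := isProbabilityMeasure_bridgeLaw d ht
  have := isProbabilityMeasure_bridgeLaw d hTp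
  have := isProbabilityMeasure_heatMeasure (d := d) hv
  have hg := measurable_glue (d := d) (T := T) hs ht
  have := Measure.isProbabilityMeasure_map hg.aemeasurable
    (μ := (heatMeasure d (s * t / T)).prod ((bridgeLaw d s).prod (bridgeLaw d t)))
  refine HasBridgeCharFun.eq (fun {ι} _ τ a => ?_) (hasBridgeCharFun_bridgeLaw d hTp)
  have hexpm : Measurable fun Φ : PathSpace d T =>
      Complex.exp ((∑ i, ⟪a i, Φ (τ i)⟫ : ℝ) * Complex.I) :=
    Complex.measurable_exp.comp ((Complex.measurable_ofReal.comp
      (Finset.measurable_sum _ fun i _ => (measurable_eval (τ i)).const_inner)).mul_const _)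
  rw [integral_map hg.aemeasurable hexpm.aestronglyMeasurable]
  set c : ι → ℝ := fun i => min ((τ i : ℝ) / s) ((T - τ i) / t) with hc
  have hsplit (p : EuclideanSpace ℝ (Fin d) × PathSpace d s × PathSpace d t) :
      Complex.exp ((∑ i, ⟪a i, glue d T hs ht p (τ i)⟫ : ℝ) * Complex.I) =
        Complex.exp ((⟪∑ i, c i • a i, p.1⟫ : ℝ) * Complex.I) *
        (Complex.exp ((∑ i, ⟪a i, p.2.1 (Set.projIcc 0 s hs.le (τ i))⟫ : ℝ) * Complex.I) *
        Complex.exp ((∑ i, ⟪a i, p.2.2 (Set.projIcc 0 t ht.le (τ i - s))⟫ : ℝ) * Complex.I)) := by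
    rw [← Complex.exp_add, ← Complex.exp_add, ← add_mul, ← add_mul]
    congr 2
    simp only [glue, ContinuousMap.coe_mk, inner_add_right, inner_smul_right, sum_inner,
      inner_smul_left, conj_trivial, Finset.sum_add_distrib]
    push_cast
    ring
  simp only [hsplit]
  rw [integral_prod_mul
      (fun y => Complex.exp ((⟪∑ i, c i • a i, y⟫ : ℝ) * Complex.I))
      (fun q : PathSpace d s × PathSpace d t =>
        Complex.exp ((∑ i, ⟪a i, q.1 (Set.projIcc 0 s hs.le (τ i))⟫ : ℝ) * Complex.I) *
        Complex.exp ((∑ i, ⟪a i, q.2 (Set.projIcc 0 t ht.le (τ i - s))⟫ : ℝ) * Complex.I)),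
    integral_prod_mul
      (fun Φ : PathSpace d s =>
        Complex.exp ((∑ i, ⟪a i, Φ (Set.projIcc 0 s hs.le (τ i))⟫ : ℝ) * Complex.I))
      (fun Φ : PathSpace d t =>
        Complex.exp ((∑ i, ⟪a i, Φ (Set.projIcc 0 t ht.le (τ i - s))⟫ : ℝ) * Complex.I)),
    integral_exp_heatMeasure hv, hasBridgeCharFun_bridgeLaw d hs _ a,
    hasBridgeCharFun_bridgeLaw d ht _ a, ← Complex.exp_add, ← Complex.exp_add]
  have hnorm : s * t / T * ‖∑ i, c i • a i‖ ^ 2 =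
      ∑ i, ∑ j, s * t / T * (c i * c j) * ⟪a i, a j⟫ := by
    rw [← real_inner_self_eq_norm_sq, sum_inner, Finset.mul_sum]
    refine Finset.sum_congr rfl fun i _ => ?_
    rw [inner_sum, Finset.mul_sum]
    refine Finset.sum_congr rfl fun j _ => ?_
    rw [inner_smul_left, inner_smul_right, conj_trivial]
    ring
  have hsum : ∑ i, ∑ j, bridgeCov T (τ i) (τ j) * ⟪a i, a j⟫ =
      s * t / T * ‖∑ i, c i • a i‖ ^ 2 +
      (∑ i, ∑ j, bridgeCov s (Set.projIcc 0 s hs.le (τ i)) (Set.projIcc 0 s hs.le (τ j)) *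
        ⟪a i, a j⟫ +
      ∑ i, ∑ j, bridgeCov t (Set.projIcc 0 t ht.le (τ i - s)) (Set.projIcc 0 t ht.le (τ j - s)) *
        ⟪a i, a j⟫) := by
    rw [hnorm]
    simp only [← Finset.sum_add_distrib]
    refine Finset.sum_congr rfl fun i _ => Finset.sum_congr rfl fun j _ => ?_
    rw [← bridgeCov_add hs ht hT (τ i) (τ j)]
    ring
  rw [hsum]
  congr 1
  push_cast
  ring

end Glue

section Reverse

variable {T : ℝ}

/-- Time reversal on `[0,T]`. -/
def reverseTime (T : ℝ) : C(Set.Icc (0 : ℝ) T, Set.Icc (0 : ℝ) T) where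
  toFun u := ⟨T - u, by linarith [u.2.2], by linarith [u.2.1]⟩
  continuous_toFun := by fun_prop

/-- The time reversal of a path. -/
def reversePath (T : ℝ) (Φ : PathSpace d T) : PathSpace d T := Φ.comp (reverseTime T)

lemma measurable_reversePath : Measurable (reversePath (d := d) T) :=
  measurable_pathSpace fun _ => measurable_eval _

theorem map_reversePath_bridgeLaw (hT : 0 < T) :
    (bridgeLaw d T).map (reversePath T) = bridgeLaw d T := by
  have := isProbabilityMeasure_bridgeLaw d hT
  have := Measure.isProbabilityMeasure_map (μ := bridgeLaw d T)
    (measurable_reversePath (d := d)).aemeasurable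
  refine HasBridgeCharFun.eq (fun {ι} _ τ a => ?_) (hasBridgeCharFun_bridgeLaw d hT)
  have hexpm : Measurable fun Φ : PathSpace d T =>
      Complex.exp ((∑ i, ⟪a i, Φ (τ i)⟫ : ℝ) * Complex.I) :=
    Complex.measurable_exp.comp ((Complex.measurable_ofReal.comp
      (Finset.measurable_sum _ fun i _ => (measurable_eval (τ i)).const_inner)).mul_const _)
  rw [integral_map measurable_reversePath.aemeasurable hexpm.aestronglyMeasurable]
  have := hasBridgeCharFun_bridgeLaw d hT (fun i => reverseTime T (τ i)) a
  simp only [reversePath, ContinuousMap.comp_apply]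
  rw [this]
  have hcov (u v : Set.Icc (0 : ℝ) T) :
      bridgeCov T (reverseTime T u) (reverseTime T v) = bridgeCov T u v := by
    simp only [bridgeCov, reverseTime, ContinuousMap.coe_mk, min_sub_sub_left]
    rw [eq_sub_of_add_eq (max_add_min (u : ℝ) v)]
    field_simp
    ring
  simp only [hcov]

end Reverse

end Decomposition

/-! ### The Feynman-Kac kernel: energy, symmetry, Markov property -/

section FeynmanKacKernel

variable {d : ℕ} {V : EuclideanSpace ℝ (Fin d) → ℝ}

/-- The integral of the potential `V` along a path. -/
noncomputable def energy {T : ℝ} (V : EuclideanSpace ℝ (Fin d) → ℝ) (Φ : PathSpace d T) : ℝ :=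
  ∫ s : Set.Icc (0 : ℝ) T, V (Φ s) ∂(lebesgueIcc T)

/-- The affine path from `x` to `y` on `[0,T]`. -/
noncomputable def line (T : ℝ) (x y : EuclideanSpace ℝ (Fin d)) : PathSpace d T where
  toFun s := T⁻¹ • ((s : ℝ) • y + (T - (s : ℝ)) • x)
  continuous_toFun := by fun_prop

lemma kernel_eq (V : EuclideanSpace ℝ (Fin d) → ℝ) (t : ℝ) (x y : EuclideanSpace ℝ (Fin d)) :
    kernel d V t x y =
      heatKernel d t x y * ∫ Φ, Real.exp (-energy V (Φ + line t x y)) ∂(bridgeLaw d t) := rfl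

instance (T : ℝ) : IsFiniteMeasure (lebesgueIcc T) := by
  refine ⟨?_⟩
  rw [lebesgueIcc, Measure.comap_apply _ Subtype.val_injective
    (fun _ h => measurableSet_Icc.subtype_image h) _ MeasurableSet.univ, Set.image_univ, Subtype.range_coe]
  exact measure_Icc_lt_top

lemma measureReal_lebesgueIcc {T : ℝ} (hT : 0 ≤ T) : (lebesgueIcc T).real Set.univ = T := by
  rw [measureReal_def, lebesgueIcc, Measure.comap_apply _ Subtype.val_injective
    (fun _ h => measurableSet_Icc.subtype_image h) _ MeasurableSet.univ, Set.image_univ, Subtype.range_coe]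
  simp [hT]

/-- Extending paths constantly beyond the interval makes the splitting, shift and reflection rules
for interval integrals available. -/
lemma energy_eq_intervalIntegral {T : ℝ} (hT : 0 ≤ T) (Φ : PathSpace d T) :
    energy V Φ = ∫ u in (0 : ℝ)..T, V (Φ (Set.projIcc 0 T hT u)) := by
  rw [intervalIntegral.integral_of_le hT, ← integral_Icc_eq_integral_Ioc,
    ← integral_subtype_comap measurableSet_Icc, energy]
  refine integral_congr_ae (ae_of_all _ fun u => ?_)
  simp only [Set.projIcc_val]

lemma integrable_comp_path (hV : Continuous V) {T : ℝ} (Φ : PathSpace d T) :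
    Integrable (fun s => V (Φ s)) (lebesgueIcc T) :=
  (hV.comp Φ.continuous).integrable_of_hasCompactSupport (HasCompactSupport.of_compactSpace _)

lemma mul_le_energy (hV : Continuous V) {m : ℝ} (hm : ∀ x, m ≤ V x) {T : ℝ} (hT : 0 ≤ T)
    (Φ : PathSpace d T) : T * m ≤ energy V Φ := by
  have := integral_mono (μ := lebesgueIcc T) (integrable_const m) (integrable_comp_path hV Φ)
    fun s => hm (Φ s)
  rwa [integral_const, measureReal_lebesgueIcc hT, smul_eq_mul] at this

lemma measurable_energy (hV : Continuous V) (T : ℝ) :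
    Measurable (energy V : PathSpace d T → ℝ) := by
  have h : Measurable (Function.uncurry fun (s : Set.Icc (0 : ℝ) T) (Φ : PathSpace d T) => V (Φ s)) :=
    measurable_uncurry_of_continuous_of_measurable (fun Φ => hV.comp Φ.continuous)
      fun s => hV.measurable.comp (measurable_eval s)
  exact (h.comp measurable_swap).stronglyMeasurable.integral_prod_right'.measurable

lemma energy_eq_add (hV : Continuous V) {s t T : ℝ} (hs : 0 ≤ s) (ht : 0 ≤ t) (hT : T = s + t)
    {Φ : PathSpace d T} {Φ₁ : PathSpace d s} {Φ₂ : PathSpace d t}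
    (h₁ : ∀ (u : Set.Icc 0 s) (v : Set.Icc 0 T), (v : ℝ) = u → Φ v = Φ₁ u)
    (h₂ : ∀ (u : Set.Icc 0 t) (v : Set.Icc 0 T), (v : ℝ) = s + u → Φ v = Φ₂ u) :
    energy V Φ = energy V Φ₁ + energy V Φ₂ := by
  have hT0 : 0 ≤ T := by linarith
  have hc : Continuous fun u => V (Φ (Set.projIcc 0 T hT0 u)) :=
    hV.comp (Φ.continuous.comp continuous_projIcc)
  rw [energy_eq_intervalIntegral hT0, energy_eq_intervalIntegral hs, energy_eq_intervalIntegral ht,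
    ← intervalIntegral.integral_add_adjacent_intervals (hc.intervalIntegrable 0 s)
      (hc.intervalIntegrable s T)]
  congr 1
  · refine intervalIntegral.integral_congr fun u hu => ?_
    rw [Set.uIcc_of_le hs] at hu
    rw [h₁ (Set.projIcc 0 s hs u)]
    rw [Set.projIcc_of_mem hs hu, Set.projIcc_of_mem hT0 ⟨hu.1, by linarith [hu.2]⟩]
  · have := intervalIntegral.integral_comp_add_left (a := 0) (b := t)
      (fun u => V (Φ (Set.projIcc 0 T hT0 u))) s
    rw [add_zero, ← hT] at this
    rw [← this]
    refine intervalIntegral.integral_congr fun u hu => ?_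
    rw [Set.uIcc_of_le ht] at hu
    rw [h₂ (Set.projIcc 0 t ht u)]
    rw [Set.projIcc_of_mem ht hu,
      Set.projIcc_of_mem hT0 ⟨by linarith [hu.1], by linarith [hu.2]⟩]

lemma energy_reversePath {T : ℝ} (hT : 0 ≤ T) (Φ : PathSpace d T) :
    energy V (reversePath T Φ) = energy V Φ := by
  rw [energy_eq_intervalIntegral hT, energy_eq_intervalIntegral hT]
  have := intervalIntegral.integral_comp_sub_left (a := 0) (b := T)
      (fun u => V (Φ (Set.projIcc 0 T hT u))) T
  rw [sub_self, sub_zero] at this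
  rw [← this]
  refine intervalIntegral.integral_congr fun u hu => ?_
  rw [Set.uIcc_of_le hT] at hu
  simp only [reversePath, reverseTime, ContinuousMap.comp_apply, ContinuousMap.coe_mk]
  rw [Set.projIcc_of_mem hT hu, Set.projIcc_of_mem hT (x := T - u) ⟨by linarith [hu.2], by linarith [hu.1]⟩]

lemma measurable_weight (hV : Continuous V) (T : ℝ) :
    Measurable fun Φ : PathSpace d T => ENNReal.ofReal (Real.exp (-energy V Φ)) :=
  (Real.measurable_exp.comp (measurable_energy hV T).neg).ennreal_ofReal

lemma measurable_add_line (t : ℝ) :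
    Measurable fun p : (EuclideanSpace ℝ (Fin d) × EuclideanSpace ℝ (Fin d)) × PathSpace d t =>
      p.2 + line t p.1.1 p.1.2 := by
  refine measurable_pathSpace fun s => ?_
  have h : Continuous fun q : EuclideanSpace ℝ (Fin d) × EuclideanSpace ℝ (Fin d) =>
      t⁻¹ • ((s : ℝ) • q.2 + (t - (s : ℝ)) • q.1) := by fun_prop
  exact ((measurable_eval s).comp measurable_snd).add (h.measurable.comp measurable_fst)

lemma measurable_add_const_path {t : ℝ} (Ψ : PathSpace d t) :
    Measurable fun Φ : PathSpace d t => Φ + Ψ :=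
  measurable_pathSpace fun s => (measurable_eval s).add_const _

/-- The Feynman-Kac expectation over bridges from `x` to `y`, as a Lebesgue integral. -/
noncomputable def bridgeWeight (V : EuclideanSpace ℝ (Fin d) → ℝ) (t : ℝ)
    (x y : EuclideanSpace ℝ (Fin d)) : ℝ≥0∞ :=
  ∫⁻ Φ, ENNReal.ofReal (Real.exp (-energy V (Φ + line t x y))) ∂(bridgeLaw d t)

lemma measurable_bridgeWeight (hV : Continuous V) (t : ℝ) :
    Measurable fun z : EuclideanSpace ℝ (Fin d) × EuclideanSpace ℝ (Fin d) =>
      bridgeWeight V t z.1 z.2 :=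
  ((measurable_weight hV t).comp (measurable_add_line t)).lintegral_prod_right'

lemma kernel_nonneg (V : EuclideanSpace ℝ (Fin d) → ℝ) {t : ℝ} (ht : 0 < t)
    (x y : EuclideanSpace ℝ (Fin d)) : 0 ≤ kernel d V t x y := by
  rw [kernel_eq]
  exact mul_nonneg (heatKernel_nonneg ht x y) (integral_nonneg fun _ => (Real.exp_pos _).le)

lemma integrable_weight (hV : Continuous V) {m : ℝ} (hm : ∀ x, m ≤ V x) {t : ℝ} (ht : 0 < t)
    (x y : EuclideanSpace ℝ (Fin d)) :
    Integrable (fun Φ => Real.exp (-energy V (Φ + line t x y))) (bridgeLaw d t) := by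
  refine Integrable.mono' (integrable_const (Real.exp (-(t * m)))) ?_ (ae_of_all _ fun Φ => ?_)
  · exact (Real.measurable_exp.comp ((measurable_energy hV t).comp
      (measurable_add_const_path _)).neg).aestronglyMeasurable
  · rw [Real.norm_of_nonneg (Real.exp_pos _).le]
    exact Real.exp_le_exp.2 (neg_le_neg (mul_le_energy hV hm ht.le _))

lemma ofReal_kernel (hV : Continuous V) {m : ℝ} (hm : ∀ x, m ≤ V x) {t : ℝ} (ht : 0 < t)
    (x y : EuclideanSpace ℝ (Fin d)) :
    ENNReal.ofReal (kernel d V t x y) =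
      ENNReal.ofReal (heatKernel d t x y) * bridgeWeight V t x y := by
  rw [kernel_eq, ENNReal.ofReal_mul (heatKernel_nonneg ht x y), bridgeWeight,
    ofReal_integral_eq_lintegral_ofReal (integrable_weight hV hm ht x y)
      (ae_of_all _ fun _ => (Real.exp_pos _).le)]

lemma kernel_eq_toReal (hV : Continuous V) {m : ℝ} (hm : ∀ x, m ≤ V x) {t : ℝ} (ht : 0 < t)
    (x y : EuclideanSpace ℝ (Fin d)) :
    kernel d V t x y = (ENNReal.ofReal (heatKernel d t x y) * bridgeWeight V t x y).toReal := by
  rw [← ofReal_kernel hV hm ht, ENNReal.toReal_ofReal (kernel_nonneg V ht x y)]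

lemma measurable_kernel (hV : Continuous V) {m : ℝ} (hm : ∀ x, m ≤ V x) {t : ℝ} (ht : 0 < t) :
    Measurable fun z : EuclideanSpace ℝ (Fin d) × EuclideanSpace ℝ (Fin d) =>
      kernel d V t z.1 z.2 := by
  simp only [kernel_eq_toReal hV hm ht]
  exact ((continuous_heatKernel t).measurable.ennreal_ofReal.mul
    (measurable_bridgeWeight hV t)).ennreal_toReal

lemma kernel_le (hV : Continuous V) {m : ℝ} (hm : ∀ x, m ≤ V x) {t : ℝ} (ht : 0 < t)
    (x y : EuclideanSpace ℝ (Fin d)) :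
    kernel d V t x y ≤ (2 * Real.pi * t) ^ (-(d : ℝ) / 2) * Real.exp (-(t * m)) := by
  have := isProbabilityMeasure_bridgeLaw d ht
  rw [kernel_eq]
  refine mul_le_mul ?_ ?_ (integral_nonneg fun _ => (Real.exp_pos _).le) (by positivity)
  · refine mul_le_of_le_one_right (by positivity) (Real.exp_le_one_iff.2 ?_)
    exact div_nonpos_of_nonpos_of_nonneg (neg_nonpos.2 (by positivity)) (by positivity)
  · have := integral_mono (integrable_weight hV hm ht x y) (integrable_const (Real.exp (-(t * m))))
      fun Φ => Real.exp_le_exp.2 (neg_le_neg (mul_le_energy hV hm ht.le _))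
    simpa using this

/-- Time reversal preserves the bridge law and the energy, and exchanges the ends of the affine
path. -/
theorem kernel_comm (hV : Continuous V) {t : ℝ} (ht : 0 < t)
    (x y : EuclideanSpace ℝ (Fin d)) : kernel d V t x y = kernel d V t y x := by
  rw [kernel_eq, kernel_eq]
  congr 1
  · rw [heatKernel, heatKernel, norm_sub_rev]
  · rw [← map_reversePath_bridgeLaw ht, integral_map measurable_reversePath.aemeasurable,
      map_reversePath_bridgeLaw ht]
    · congr 1
      ext Φ
      rw [← energy_reversePath ht.le (Φ + line t y x)]
      congr 3
      ext1 u
      simp only [reversePath, line, reverseTime, ContinuousMap.comp_apply, ContinuousMap.coe_mk,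
        ContinuousMap.add_apply]
      congr 2
      rw [sub_sub_cancel, add_comm]
    · exact (Real.measurable_exp.comp ((measurable_energy hV t).comp
        (measurable_add_const_path _)).neg).aestronglyMeasurable

lemma heatKernel_mul_heatKernel {s t T : ℝ} (hs : 0 < s) (ht : 0 < t) (hT : T = s + t)
    (x y z : EuclideanSpace ℝ (Fin d)) :
    heatKernel d T x z * heatKernel d (s * t / T) 0 (y - T⁻¹ • (s • z + (T - s) • x)) =
      heatKernel d s x y * heatKernel d t y z := by
  have hTp : 0 < T := by linarith
  simp only [heatKernel]
  have hpow : (2 * Real.pi * T) ^ (-(d : ℝ) / 2) * (2 * Real.pi * (s * t / T)) ^ (-(d : ℝ) / 2) =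
      (2 * Real.pi * s) ^ (-(d : ℝ) / 2) * (2 * Real.pi * t) ^ (-(d : ℝ) / 2) := by
    rw [← Real.mul_rpow (by positivity) (by positivity),
      ← Real.mul_rpow (by positivity) (by positivity)]
    congr 1
    field_simp
  -- With `p = x - y` and `q = y - z`, this is |p|²/s + |q|²/t = |p + q|²/T + |tp - sq|²/(stT).
  have hexp : -‖x - z‖ ^ 2 / (2 * T) +
      -‖0 - (y - T⁻¹ • (s • z + (T - s) • x))‖ ^ 2 / (2 * (s * t / T)) =
      -‖x - y‖ ^ 2 / (2 * s) + -‖y - z‖ ^ 2 / (2 * t) := by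
    have e1 : x - z = (x - y) + (y - z) := by abel
    have e2 : 0 - (y - T⁻¹ • (s • z + (T - s) • x)) = T⁻¹ • (t • (x - y) - s • (y - z)) := by
      have : y = T⁻¹ • (T • y) := by rw [smul_smul, inv_mul_cancel₀ hTp.ne', one_smul]
      nth_rw 1 [this]
      rw [hT]
      module
    rw [e1, e2]
    generalize x - y = p
    generalize y - z = q
    rw [norm_smul, mul_pow, norm_add_sq_real, norm_sub_sq_real, norm_smul, norm_smul,
      inner_smul_left, inner_smul_right, conj_trivial, Real.norm_of_nonneg hs.le,
      Real.norm_of_nonneg ht.le, Real.norm_of_nonneg (by positivity)]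
    subst hT
    field_simp
    ring
  calc _ = ((2 * Real.pi * T) ^ (-(d : ℝ) / 2) * (2 * Real.pi * (s * t / T)) ^ (-(d : ℝ) / 2)) *
        Real.exp (-‖x - z‖ ^ 2 / (2 * T) +
          -‖0 - (y - T⁻¹ • (s • z + (T - s) • x))‖ ^ 2 / (2 * (s * t / T))) := by
        rw [Real.exp_add]; ring
    _ = _ := by rw [hpow, hexp, Real.exp_add]; ring

/-- Up to time `s` the second bridge is frozen at its initial value, which `hp` makes zero; the two
affine parts add up to the segment from `x` to the value at time `s`. -/
lemma glue_add_line_of_le {s t T : ℝ} (hs : 0 < s) (ht : 0 < t) (hT : T = s + t)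
    (x z : EuclideanSpace ℝ (Fin d))
    {p : EuclideanSpace ℝ (Fin d) × PathSpace d s × PathSpace d t}
    (hp : p.2.2 ⟨0, le_rfl, ht.le⟩ = 0) (u : Set.Icc 0 s) (v : Set.Icc 0 T) (hv : (v : ℝ) = u) :
    (glue d T hs ht p + line T x z) v =
      (p.2.1 + line s x (p.1 + T⁻¹ • (s • z + (T - s) • x))) u := by
  have hTp : 0 < T := by linarith
  have hmin : min ((u : ℝ) / s) ((T - u) / t) = u / s := by
    refine min_eq_left ?_
    rw [div_le_div_iff₀ hs ht]
    nlinarith [u.2.2]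
  simp only [ContinuousMap.add_apply, glue, line, ContinuousMap.coe_mk, hv, hmin]
  rw [Set.projIcc_val, Set.projIcc_of_le_left ht.le (by linarith [u.2.2]), hp, add_zero, add_assoc]
  congr 1
  subst hT
  (match_scalars <;> field_simp); ring

lemma glue_add_line_of_ge {s t T : ℝ} (hs : 0 < s) (ht : 0 < t) (hT : T = s + t)
    (x z : EuclideanSpace ℝ (Fin d))
    {p : EuclideanSpace ℝ (Fin d) × PathSpace d s × PathSpace d t}
    (hp : p.2.1 ⟨s, hs.le, le_rfl⟩ = 0) (u : Set.Icc 0 t) (v : Set.Icc 0 T)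
    (hv : (v : ℝ) = s + u) :
    (glue d T hs ht p + line T x z) v =
      (p.2.2 + line t (p.1 + T⁻¹ • (s • z + (T - s) • x)) z) u := by
  have hTp : 0 < T := by linarith
  have hmin : min ((s + u : ℝ) / s) ((T - (s + u)) / t) = (T - (s + u)) / t := by
    refine min_eq_right ?_
    rw [div_le_div_iff₀ ht hs]
    nlinarith [u.2.1]
  simp only [ContinuousMap.add_apply, glue, line, ContinuousMap.coe_mk, hv, hmin]
  rw [add_sub_cancel_left, Set.projIcc_val, Set.projIcc_of_right_le hs.le (by linarith [u.2.1]), hp,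
    zero_add, add_assoc]
  congr 1
  subst hT
  match_scalars <;> field_simp <;> ring

/-- With the Gaussian height `y` fixed, the value at time `s` is almost surely deterministic and the
two halves are independent, so the integral factors. -/
lemma lintegral_glue_eq (hV : Continuous V) {s t T : ℝ} (hs : 0 < s) (ht : 0 < t)
    (hT : T = s + t) (hsT : s ∈ Set.Icc 0 T) (x y z : EuclideanSpace ℝ (Fin d))
    (g : EuclideanSpace ℝ (Fin d) → ℝ≥0∞) :
    ∫⁻ q, g ((glue d T hs ht (y, q) + line T x z) ⟨s, hsT⟩) *
        ENNReal.ofReal (Real.exp (-energy V (glue d T hs ht (y, q) + line T x z)))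
        ∂((bridgeLaw d s).prod (bridgeLaw d t)) =
      g (y + T⁻¹ • (s • z + (T - s) • x)) *
        (bridgeWeight V s x (y + T⁻¹ • (s • z + (T - s) • x)) *
          bridgeWeight V t (y + T⁻¹ • (s • z + (T - s) • x)) z) := by
  have h0s : ∀ᵐ q ∂((bridgeLaw d s).prod (bridgeLaw d t)), q.1 ⟨s, hs.le, le_rfl⟩ = 0 :=
    Measure.quasiMeasurePreserving_fst.ae (ae_bridgeLaw_eval_eq_zero hs (by
      simp only [bridgeCov]; field_simp; simp))
  have h0t : ∀ᵐ q ∂((bridgeLaw d s).prod (bridgeLaw d t)), q.2 ⟨0, le_rfl, ht.le⟩ = 0 :=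
    Measure.quasiMeasurePreserving_snd.ae (ae_bridgeLaw_eval_eq_zero ht (by simp [bridgeCov]))
  have hle (q : PathSpace d s × PathSpace d t) :=
    glue_add_line_of_le hs ht hT x z (p := (y, q))
  have hge (q : PathSpace d s × PathSpace d t) :=
    glue_add_line_of_ge hs ht hT x z (p := (y, q))
  generalize T⁻¹ • (s • z + (T - s) • x) = c at hle hge ⊢
  have hae : (fun q => g ((glue d T hs ht (y, q) + line T x z) ⟨s, hsT⟩) *
      ENNReal.ofReal (Real.exp (-energy V (glue d T hs ht (y, q) + line T x z))))
      =ᵐ[(bridgeLaw d s).prod (bridgeLaw d t)] fun q => g (y + c) *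
        (ENNReal.ofReal (Real.exp (-energy V (q.1 + line s x (y + c)))) *
        ENNReal.ofReal (Real.exp (-energy V (q.2 + line t (y + c) z)))) := by
    filter_upwards [h0s, h0t] with q hq1 hq2
    have h1 := hle q hq2
    have h2 := hge q hq1
    rw [energy_eq_add hV hs.le ht.le hT h1 h2, h1 ⟨s, hs.le, le_rfl⟩ ⟨s, hsT⟩ rfl, neg_add,
      Real.exp_add, ENNReal.ofReal_mul (Real.exp_pos _).le]
    congr 2
    simp only [ContinuousMap.add_apply, hq1, zero_add, line, ContinuousMap.coe_mk, sub_self,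
      zero_smul, add_zero]
    rw [smul_smul, inv_mul_cancel₀ hs.ne', one_smul]
  rw [lintegral_congr_ae hae]
  have m1 : Measurable fun Φ : PathSpace d s =>
      ENNReal.ofReal (Real.exp (-energy V (Φ + line s x (y + c)))) :=
    (measurable_weight hV s).comp (measurable_add_const_path _)
  have m2 : Measurable fun Φ : PathSpace d t =>
      ENNReal.ofReal (Real.exp (-energy V (Φ + line t (y + c) z))) :=
    (measurable_weight hV t).comp (measurable_add_const_path _)
  have m12 : Measurable fun q : PathSpace d s × PathSpace d t =>
      ENNReal.ofReal (Real.exp (-energy V (q.1 + line s x (y + c)))) *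
        ENNReal.ofReal (Real.exp (-energy V (q.2 + line t (y + c) z))) :=
    (m1.comp measurable_fst).mul (m2.comp measurable_snd)
  rw [lintegral_const_mul _ m12, lintegral_prod_mul m1.aemeasurable m2.aemeasurable]
  rfl

lemma lintegral_heatMeasure_add (v : ℝ) {f : EuclideanSpace ℝ (Fin d) → ℝ≥0∞} (hf : Measurable f)
    (c : EuclideanSpace ℝ (Fin d)) :
    ∫⁻ y, f (y + c) ∂(heatMeasure d v) =
      ∫⁻ y, ENNReal.ofReal (heatKernel d v 0 (y - c)) * f y := by
  have hfc : Measurable fun y => f (y + c) := hf.comp (measurable_id.add_const c)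
  rw [heatMeasure, lintegral_withDensity_eq_lintegral_mul _
    (measurable_heatKernel_zero v).ennreal_ofReal hfc, ← lintegral_sub_right_eq_self _ c]
  simp only [Pi.mul_apply, sub_add_cancel]

/-- The Markov property at time `s`. Keeping `g` arbitrary serves both conclusions: a constant gives
the semigroup, an indicator the law of the value at time `s`. -/
theorem lintegral_bridge_eq (hV : Continuous V) {m : ℝ} (hm : ∀ x, m ≤ V x) {s t T : ℝ}
    (hs : 0 < s) (ht : 0 < t) (hT : T = s + t) (hsT : s ∈ Set.Icc 0 T)
    (x z : EuclideanSpace ℝ (Fin d)) {g : EuclideanSpace ℝ (Fin d) → ℝ≥0∞} (hg : Measurable g) :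
    ENNReal.ofReal (heatKernel d T x z) *
      ∫⁻ Φ, g ((Φ + line T x z) ⟨s, hsT⟩) *
        ENNReal.ofReal (Real.exp (-energy V (Φ + line T x z))) ∂(bridgeLaw d T) =
      ∫⁻ y, g y * ENNReal.ofReal (kernel d V s x y * kernel d V t y z) := by
  have hTp : 0 < T := by linarith
  have hF : Measurable fun Φ : PathSpace d T => g ((Φ + line T x z) ⟨s, hsT⟩) *
      ENNReal.ofReal (Real.exp (-energy V (Φ + line T x z))) :=
    (hg.comp ((measurable_eval _).comp (measurable_add_const_path _))).mul
      ((measurable_weight hV T).comp (measurable_add_const_path _))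
  have hFg : Measurable fun p => g ((glue d T hs ht p + line T x z) ⟨s, hsT⟩) *
      ENNReal.ofReal (Real.exp (-energy V (glue d T hs ht p + line T x z))) :=
    hF.comp (measurable_glue hs ht)
  rw [← map_glue_bridgeLaw hs ht hT, lintegral_map hF (measurable_glue hs ht),
    lintegral_prod _ hFg.aemeasurable,
    lintegral_congr fun y => lintegral_glue_eq hV hs ht hT hsT x y z g]
  have hW1 : Measurable fun y => bridgeWeight V s x y :=
    Measurable.of_uncurry_left (f := bridgeWeight V s) (measurable_bridgeWeight hV s)
  have hW2 : Measurable fun y => bridgeWeight V t y z :=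
    Measurable.of_uncurry_right (f := bridgeWeight V t) (measurable_bridgeWeight hV t)
  have hG : Measurable fun y => g y * (bridgeWeight V s x y * bridgeWeight V t y z) :=
    hg.mul (hW1.mul hW2)
  have hH := (measurable_heatKernel_zero (d := d) (s * t / T)).ennreal_ofReal
  have hheat (y : EuclideanSpace ℝ (Fin d)) := heatKernel_mul_heatKernel hs ht hT x y z
  generalize T⁻¹ • (s • z + (T - s) • x) = c at hheat ⊢
  have hHG : Measurable fun y => ENNReal.ofReal (heatKernel d (s * t / T) 0 (y - c)) *
      (g y * (bridgeWeight V s x y * bridgeWeight V t y z)) :=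
    (hH.comp (measurable_id.sub_const c)).mul hG
  rw [lintegral_heatMeasure_add (s * t / T) hG c, ← lintegral_const_mul _ hHG]
  refine lintegral_congr fun y => ?_
  rw [ENNReal.ofReal_mul (kernel_nonneg V hs x y), ofReal_kernel hV hm hs, ofReal_kernel hV hm ht]
  have h2 : ENNReal.ofReal (heatKernel d T x z) *
      ENNReal.ofReal (heatKernel d (s * t / T) 0 (y - c)) =
      ENNReal.ofReal (heatKernel d s x y) * ENNReal.ofReal (heatKernel d t y z) := by
    rw [← ENNReal.ofReal_mul (heatKernel_nonneg hTp _ _),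
      ← ENNReal.ofReal_mul (heatKernel_nonneg hs _ _), hheat]
  rw [← mul_assoc, h2]
  ring

end FeynmanKacKernel

/-! ### Semigroup law, image of the loop measure, half-densities -/

section HalfDensity

variable {d : ℕ} {V : EuclideanSpace ℝ (Fin d) → ℝ}

lemma lintegral_kernel_mul_kernel (hV : Continuous V) {m : ℝ} (hm : ∀ x, m ≤ V x) {s t : ℝ}
    (hs : 0 < s) (ht : 0 < t) (x z : EuclideanSpace ℝ (Fin d)) :
    ∫⁻ y, ENNReal.ofReal (kernel d V s x y * kernel d V t y z) =
      ENNReal.ofReal (kernel d V (s + t) x z) := by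
  have h := lintegral_bridge_eq hV hm hs ht rfl ⟨hs.le, by linarith⟩ x z
    (g := fun _ => 1) measurable_const
  simp only [one_mul] at h
  rw [← h, ofReal_kernel hV hm (add_pos hs ht)]
  rfl

theorem kernel_semigroup (hV : Continuous V) {m : ℝ} (hm : ∀ x, m ≤ V x) {s t : ℝ}
    (hs : 0 < s) (ht : 0 < t) (x z : EuclideanSpace ℝ (Fin d)) :
    Integrable (fun y => kernel d V s x y * kernel d V t y z) volume ∧
      ∫ y, kernel d V s x y * kernel d V t y z = kernel d V (s + t) x z := by
  have h := lintegral_kernel_mul_kernel hV hm hs ht x z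
  have hmeas : AEStronglyMeasurable (fun y => kernel d V s x y * kernel d V t y z) volume :=
    ((Measurable.of_uncurry_left (f := kernel d V s) (measurable_kernel hV hm hs)).mul
      (Measurable.of_uncurry_right (f := kernel d V t)
        (measurable_kernel hV hm ht))).aestronglyMeasurable
  have hnn : 0 ≤ᵐ[volume] fun y => kernel d V s x y * kernel d V t y z :=
    ae_of_all _ fun y => mul_nonneg (kernel_nonneg V hs x y) (kernel_nonneg V ht y z)
  refine ⟨⟨hmeas, ?_⟩, ?_⟩
  · rw [hasFiniteIntegral_iff_ofReal hnn, h]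
    exact ENNReal.ofReal_lt_top
  · rw [integral_eq_lintegral_of_nonneg_ae hnn hmeas, h,
      ENNReal.toReal_ofReal (kernel_nonneg V (add_pos hs ht) x z)]

lemma measurable_translate (T : ℝ) :
    Measurable fun p : EuclideanSpace ℝ (Fin d) × PathSpace d T => translate d T p.1 p.2 :=
  measurable_pathSpace fun s => ((measurable_eval s).comp measurable_snd).add measurable_fst

lemma measurable_map_translate (T : ℝ) :
    Measurable fun c => (bridgeLaw d T).map (translate d T c) := by
  refine Measure.measurable_of_measurable_coe _ fun A hA => ?_
  have h (c : EuclideanSpace ℝ (Fin d)) : (bridgeLaw d T).map (translate d T c) A =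
      bridgeLaw d T (Prod.mk c ⁻¹' ((fun p => translate d T p.1 p.2) ⁻¹' A)) :=
    Measure.map_apply ((measurable_translate T).comp measurable_prodMk_left) hA
  simp only [h]
  exact measurable_measure_prodMk_left (measurable_translate T hA)

lemma lintegral_freeLoopMeasure (t : ℝ) {f : PathSpace d (2 * t) → ℝ≥0∞} (hf : Measurable f) :
    ∫⁻ Φ, f Φ ∂(freeLoopMeasure d t) =
      ∫⁻ c, ∫⁻ Φ, f (translate d (2 * t) c Φ) ∂(bridgeLaw d (2 * t)) := by
  rw [freeLoopMeasure, Measure.lintegral_bind (measurable_map_translate _).aemeasurable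
    hf.aemeasurable]
  refine lintegral_congr fun c => ?_
  exact lintegral_map hf ((measurable_translate (2 * t)).comp measurable_prodMk_left)

/-- This identifies a translated loop with a bridge from `c` to `c`, to which `lintegral_bridge_eq`
applies. -/
lemma translate_eq_add_line {T : ℝ} (hT : 0 < T) (c : EuclideanSpace ℝ (Fin d))
    (Φ : PathSpace d T) : translate d T c Φ = Φ + line T c c := by
  rw [translate]
  congr 1
  ext1 s
  simp only [ContinuousMap.const_apply, line, ContinuousMap.coe_mk]
  rw [← add_smul, add_sub_cancel, smul_smul, inv_mul_cancel₀ hT.ne', one_smul]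

lemma measurable_endpoints {t : ℝ} (ht : 0 < t) : Measurable (endpoints d t ht) :=
  (measurable_eval _).prodMk (measurable_eval _)

theorem map_endpoints_loopMeasure (hV : Continuous V) {m : ℝ} (hm : ∀ x, m ≤ V x) {t : ℝ}
    (ht : 0 < t) :
    (loopMeasure d V t).map (endpoints d t ht) =
      volume.withDensity fun z => ENNReal.ofReal (kernel d V t z.1 z.2 ^ 2) := by
  have ht2 : 0 < 2 * t := by linarith
  have hE := measurable_endpoints (d := d) ht
  have hk : Measurable fun z : EuclideanSpace ℝ (Fin d) × EuclideanSpace ℝ (Fin d) =>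
      ENNReal.ofReal (kernel d V t z.1 z.2 ^ 2) :=
    ((measurable_kernel hV hm ht).pow_const 2).ennreal_ofReal
  ext A hA
  have hind : Measurable (A.indicator (1 : EuclideanSpace ℝ (Fin d) × EuclideanSpace ℝ (Fin d) → ℝ≥0∞)) := measurable_one.indicator hA
  have hindE : Measurable fun Φ => A.indicator
      (1 : EuclideanSpace ℝ (Fin d) × EuclideanSpace ℝ (Fin d) → ℝ≥0∞) (endpoints d t ht Φ) := hind.comp hE
  have hw := measurable_weight hV (2 * t)
  have hfm : Measurable fun Φ : PathSpace d (2 * t) =>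
      A.indicator 1 (endpoints d t ht Φ) * ENNReal.ofReal (Real.exp (-energy V Φ)) :=
    hindE.mul hw
  have hmul : Measurable fun z : EuclideanSpace ℝ (Fin d) × EuclideanSpace ℝ (Fin d) =>
      A.indicator 1 z * ENNReal.ofReal (kernel d V t z.1 z.2 ^ 2) := hind.mul hk
  -- The normalization of the loop measure is the on-diagonal heat kernel at time `2 * t`, the
  -- prefactor required by the Markov property.
  have hheat (c : EuclideanSpace ℝ (Fin d)) :
      (4 * Real.pi * t) ^ (-(d : ℝ) / 2) = heatKernel d (2 * t) c c := by
    rw [heatKernel, sub_self, norm_zero]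
    norm_num
    congr 1
    ring
  have hpath (c : EuclideanSpace ℝ (Fin d)) :
      ENNReal.ofReal ((4 * Real.pi * t) ^ (-(d : ℝ) / 2)) *
        ∫⁻ Φ, A.indicator 1 (endpoints d t ht (translate d (2 * t) c Φ)) *
          ENNReal.ofReal (Real.exp (-energy V (translate d (2 * t) c Φ))) ∂(bridgeLaw d (2 * t)) =
      ∫⁻ y, A.indicator 1 (c, y) * ENNReal.ofReal (kernel d V t c y ^ 2) := by
    have hg : Measurable fun y : EuclideanSpace ℝ (Fin d) =>
        A.indicator (1 : EuclideanSpace ℝ (Fin d) × EuclideanSpace ℝ (Fin d) → ℝ≥0∞) (c, y) := hind.comp measurable_prodMk_left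
    have h := lintegral_bridge_eq hV hm ht ht (two_mul t) ⟨ht.le, by linarith⟩ c c hg
    -- Symmetry turns the product of the kernels out to `y` and back to `c` into a square.
    simp only [fun y => kernel_comm hV ht y c, ← pow_two] at h
    rw [← h, hheat c]
    congr 1
    refine lintegral_congr_ae ?_
    -- The bridge starts at 0 almost surely, so the first endpoint of the translated loop is `c`.
    filter_upwards [ae_bridgeLaw_eval_eq_zero (d := d) ht2 (s := ⟨0, le_rfl, ht2.le⟩)
      (by simp [bridgeCov])] with Φ hΦ
    rw [translate_eq_add_line ht2]
    congr 2
    rw [endpoints, ← translate_eq_add_line ht2]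
    refine Prod.ext ?_ rfl
    simp only [translate, ContinuousMap.add_apply, ContinuousMap.const_apply, hΦ, zero_add]
  calc (loopMeasure d V t).map (endpoints d t ht) A
      = ∫⁻ Φ, A.indicator 1 (endpoints d t ht Φ) ∂(loopMeasure d V t) := by
        rw [← lintegral_map hind hE, lintegral_indicator_one hA]
    _ = ∫⁻ Φ, A.indicator 1 (endpoints d t ht Φ) * ENNReal.ofReal (Real.exp (-energy V Φ))
          ∂(ENNReal.ofReal ((4 * Real.pi * t) ^ (-(d : ℝ) / 2)) • freeLoopMeasure d t) := by
        rw [show loopMeasure d V t = (ENNReal.ofReal ((4 * Real.pi * t) ^ (-(d : ℝ) / 2)) •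
            freeLoopMeasure d t).withDensity
            fun Φ => ENNReal.ofReal (Real.exp (-energy V Φ)) from rfl,
          lintegral_withDensity_eq_lintegral_mul _ hw hindE]
        exact lintegral_congr fun Φ => mul_comm _ _
    _ = ∫⁻ c, ∫⁻ y, A.indicator 1 (c, y) * ENNReal.ofReal (kernel d V t c y ^ 2) := by
        rw [lintegral_smul_measure, lintegral_freeLoopMeasure t hfm, smul_eq_mul,
          ← lintegral_const_mul' _ _ ENNReal.ofReal_ne_top]
        exact lintegral_congr hpath
    _ = ∫⁻ z, A.indicator 1 z * ENNReal.ofReal (kernel d V t z.1 z.2 ^ 2) := by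
        rw [Measure.volume_eq_prod, lintegral_prod _ hmul.aemeasurable]
    _ = (volume.withDensity fun z => ENNReal.ofReal (kernel d V t z.1 z.2 ^ 2)) A := by
        rw [withDensity_apply _ hA, ← lintegral_indicator hA]
        refine lintegral_congr fun z => ?_
        by_cases hz : z ∈ A <;> simp [hz]

/-- Lebesgue measure serves as the common reference `μ`. The image measure is Radon because the
lower bound on `V` bounds its density; nonnegativity of the kernel makes it the square root of its
square. -/
theorem halfDensityEq_kernel (hV : Continuous V) {m : ℝ} (hm : ∀ x, m ≤ V x) {t : ℝ}
    (ht : 0 < t) :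
    HalfDensityEq
      (fun z : EuclideanSpace ℝ (Fin d) × EuclideanSpace ℝ (Fin d) => kernel d V t z.1 z.2)
      volume (fun _ => 1) ((loopMeasure d V t).map (endpoints d t ht)) := by
  rw [map_endpoints_loopMeasure hV hm ht]
  have hk := measurable_kernel hV hm ht
  set C := (2 * Real.pi * t) ^ (-(d : ℝ) / 2) * Real.exp (-(t * m)) with hC
  have hle : (volume.withDensity fun z : EuclideanSpace ℝ (Fin d) × EuclideanSpace ℝ (Fin d) =>
      ENNReal.ofReal (kernel d V t z.1 z.2 ^ 2)) ≤ ENNReal.ofReal (C ^ 2) • volume := by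
    rw [← withDensity_const]
    exact withDensity_mono (ae_of_all _ fun z => ENNReal.ofReal_le_ofReal
      (pow_le_pow_left₀ (kernel_nonneg V ht _ _) (kernel_le hV hm ht _ _) 2))
  have hfin : IsLocallyFiniteMeasure (volume.withDensity
      fun z : EuclideanSpace ℝ (Fin d) × EuclideanSpace ℝ (Fin d) =>
        ENNReal.ofReal (kernel d V t z.1 z.2 ^ 2)) := by
    refine ⟨fun x => ?_⟩
    obtain ⟨U, hU, hU'⟩ := (volume : Measure
      (EuclideanSpace ℝ (Fin d) × EuclideanSpace ℝ (Fin d))).finiteAt_nhds x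
    refine ⟨U, hU, (hle U).trans_lt ?_⟩
    rw [Measure.smul_apply, smul_eq_mul]
    exact ENNReal.mul_lt_top ENNReal.ofReal_lt_top hU'
  refine ⟨⟨inferInstance, hk.aemeasurable⟩, ⟨hfin, aemeasurable_const⟩,
    volume, inferInstance, Measure.AbsolutelyContinuous.rfl, withDensity_absolutelyContinuous _ _,
    ?_⟩
  filter_upwards [Measure.rnDeriv_self (volume : Measure
      (EuclideanSpace ℝ (Fin d) × EuclideanSpace ℝ (Fin d))),
    Measure.rnDeriv_withDensity (volume : Measure
      (EuclideanSpace ℝ (Fin d) × EuclideanSpace ℝ (Fin d))) (hk.pow_const 2).ennreal_ofReal]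
    with z h1 h2
  rw [h1, h2, ENNReal.toReal_one, Real.sqrt_one, mul_one, one_mul,
    ENNReal.toReal_ofReal (sq_nonneg _), Real.sqrt_sq (kernel_nonneg V ht _ _)]

end HalfDensity

end FeynmanKac

theorem mainTheorem2 (d : ℕ) (V : EuclideanSpace ℝ (Fin d) → ℝ)
    (hV : ContDiff ℝ ∞ V) (hV_bdd : ∃ m : ℝ, ∀ x, m ≤ V x) :
    (∀ (t : ℝ) (ht : 0 < t),
      FeynmanKac.HalfDensityEq
        (fun z : EuclideanSpace ℝ (Fin d) × EuclideanSpace ℝ (Fin d) =>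
          FeynmanKac.kernel d V t z.1 z.2)
        volume
        (fun _ => 1)
        ((FeynmanKac.loopMeasure d V t).map (FeynmanKac.endpoints d t ht))) ∧
    (∀ (s t : ℝ), 0 < s → 0 < t → ∀ x z : EuclideanSpace ℝ (Fin d),
      Integrable (fun y => FeynmanKac.kernel d V s x y * FeynmanKac.kernel d V t y z) volume ∧
      ∫ y, FeynmanKac.kernel d V s x y * FeynmanKac.kernel d V t y z =
        FeynmanKac.kernel d V (s + t) x z) := by
  obtain ⟨m, hm⟩ := hV_bdd
  exact ⟨fun t ht => FeynmanKac.halfDensityEq_kernel hV.continuous hm ht,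
    fun s t hs ht x z => FeynmanKac.kernel_semigroup hV.continuous hm hs ht x z⟩
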